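/- Let $K\ge 1$. A homeomorphism $\phi:\mathbb C\to\mathbb C$ is called $K$-quasiconformal if it belongs to $W^{1,2}_{\mathrm{loc}}(\mathbb C)$, is orientation preserving (its Jacobian is $\ge 0$ a.e.), and its directional derivatives satisfy $\max_\alpha|\partial_\alpha\phi|\le K\min_\alpha|\partial_\alpha\phi|$ a.e. in $\mathbb C$. Let $\mathcal H^s$ denote $s$-dimensional Hausdorff measure on $\mathbb C$; a set is $\mathcal H^s$-$\sigma$-finite if it is a countable union of sets of finite $\mathcal H^s$ measure. **Corollary 3.5.** There exist a compact set $F\subset\mathbb C$ and a $K$-quasiconformal mapping $\phi:\mathbb C\to\mathbb C$ such that $\mathcal H^{\frac{2}{K+1}}(F)=\infty$ but $F$ is $\mathcal H^{\frac{2}{K+1}}$-$\sigma$-finite, and $\mathcal H^{1}(\phi(F))=\infty$ but $\phi(F)$ is $\mathcal H^{1}$-$\sigma$-finite. More generally, for every $0<d<2$, with $d'=\frac{2Kd}{2+(K-1)d}$, there exist a compact set $F\subset\mathbb C$ and a $K$-quasiconformal mapping $\phi:\mathbb C\to\mathbb C$ such that $\mathcal H^{d}(F)=\infty$ but $F$ is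 $\mathcal H^{d}$-$\sigma$-finite, and $\mathcal H^{d'}(\phi(F))=\infty$ but $\phi(F)$ is $\mathcal H^{d'}$-$\sigma$-finite. -/

import Mathlib

open MeasureTheory
open scoped ContDiff

/-- `f` belongs to `L²` on every compact subset of the plane. -/
def MemL2Loc {E : Type*} [NormedAddCommGroup E] (f : ℂ → E) : Prop :=
  ∀ S : Set ℂ, IsCompact S → MemLp f 2 (volume.restrict S)

/-- `f : ℂ → ℂ` belongs to the Sobolev space `W^{1,2}_loc(ℂ)`, with distributional (real) derivative
`Df`: both are locally square integrable, and
`∫ (∂ᵥ ψ) f = - ∫ ψ (Df v)` for every test function `ψ` and every direction `v`. -/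
structure HasSobolevDeriv (f : ℂ → ℂ) (Df : ℂ → ℂ →L[ℝ] ℂ) : Prop where
  memL2Loc : MemL2Loc f
  deriv_memL2Loc : MemL2Loc Df
  integral_eq : ∀ ψ : ℂ → ℝ, ContDiff ℝ ∞ ψ → HasCompactSupport ψ → ∀ v : ℂ,
    ∫ z, (fderiv ℝ ψ z v) • f z = -∫ z, ψ z • Df z v

/-- A homeomorphism `φ` of the plane is `K`-quasiconformal: it lies in `W^{1,2}_loc(ℂ)`, it is
orientation preserving (its Jacobian determinant is nonnegative almost everywhere), and its
directional derivatives `∂_α φ(z) = Dφ(z) (exp (i α))` satisfy the distortion inequality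
`max_α |∂_α φ| ≤ K min_α |∂_α φ|` almost everywhere. -/
def IsQuasiconformal (K : ℝ) (φ : ℂ ≃ₜ ℂ) : Prop :=
  ∃ Dφ : ℂ → ℂ →L[ℝ] ℂ, HasSobolevDeriv φ Dφ ∧
    (∀ᵐ z, 0 ≤ (Dφ z).det) ∧
    (∀ᵐ z, ∀ v w : ℂ, ‖v‖ = 1 → ‖w‖ = 1 → ‖Dφ z v‖ ≤ K * ‖Dφ z w‖)

/-!
The radial stretching `z ↦ |z|^(1/K - 1) z` of a disc is `K`-quasiconformal and glues to the
identity outside it. Fill all but a small proportion of the unit disc by finitely many disjoint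
discs, stretch about each centre an annulus around a smaller concentric disc, so that the smaller
disc is mapped by a similarity, and iterate inside the smaller discs. The nested smaller discs cut
out a Cantor set `E`, their images cut out its image. The ratios are chosen so that in dimension
`d'` the target discs satisfy `∑ radius ^ d' = 1` at every generation; then in dimension `d` the
corresponding sums for the source discs change only by a power of the proportion of area which has
been covered. If the product of these proportions is positive, both sets have positive and finite
measure. For the lower bounds the discs of one generation need not be well separated: it is enough
that disjoint discs contained in a ball have at most the area of that ball.

The finite stages of the iteration are normalised homeomorphisms with derivatives bounded in `L²`,
since `‖A‖² ≤ K det A` and the Jacobian integrates to the area of the image, and they converge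
uniformly, as do their inverses; hence the limit is again quasiconformal.

Finally, the construction is repeated in infinitely many disjoint discs shrinking to the origin,
rescaled so that each contributes at least a fixed amount to the measure of the union.
-/

open Filter Metric Set Topology
open scoped ENNReal NNReal

section Distortion

/-- Pointwise distortion condition on the differential of an orientation preserving map: besides
the two pointwise conditions of `IsQuasiconformal` it records the analytic inequality
`‖A‖² ≤ K det A`, through which an area bound controls the `L²` norm of the differential. -/
structure HasDistortion (K : ℝ) (A : ℂ →L[ℝ] ℂ) : Prop where
  det_nonneg : 0 ≤ A.det
  norm_sq_le : ‖A‖ ^ 2 ≤ K * A.det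
  norm_apply_le : ∀ v w : ℂ, ‖v‖ = 1 → ‖w‖ = 1 → ‖A v‖ ≤ K * ‖A w‖

theorem det_real_smul (c : ℝ) (A : ℂ →L[ℝ] ℂ) : (c • A).det = c ^ 2 * A.det := by
  rw [ContinuousLinearMap.det, ContinuousLinearMap.toLinearMap_smul, LinearMap.det_smul,
    Complex.finrank_real_complex]

theorem HasDistortion.smul {K : ℝ} {A : ℂ →L[ℝ] ℂ} (hA : HasDistortion K A) (c : ℝ) :
    HasDistortion K (c • A) where
  det_nonneg := det_real_smul c A ▸ mul_nonneg (sq_nonneg c) hA.det_nonneg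
  norm_sq_le := by
    rw [det_real_smul, norm_smul, mul_pow, Real.norm_eq_abs, sq_abs, mul_left_comm]
    exact mul_le_mul_of_nonneg_left hA.norm_sq_le (sq_nonneg c)
  norm_apply_le v w hv hw := by
    rw [smul_apply, smul_apply, norm_smul, norm_smul, mul_left_comm]
    exact mul_le_mul_of_nonneg_left (hA.norm_apply_le v w hv hw) (norm_nonneg c)

theorem hasDistortion_id {K : ℝ} (hK : 1 ≤ K) :
    HasDistortion K (ContinuousLinearMap.id ℝ ℂ) := by
  have hdet : (ContinuousLinearMap.id ℝ ℂ).det = 1 := by simp [ContinuousLinearMap.det]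
  exact ⟨by simp [hdet], by simpa [hdet], fun v w hv hw ↦ by simpa [hv, hw]⟩

/-- The linear map that multiplies by `q` in the direction of the unit vector `e` and is the
identity in the orthogonal direction; up to a scalar, the differential of `z ↦ ‖z‖ ^ (q - 1) • z`
at a point of the ray through `e`. -/
noncomputable def radialScaling (e : ℂ) (q : ℝ) : ℂ →L[ℝ] ℂ :=
  ContinuousLinearMap.id ℝ ℂ + (q - 1) • (innerSL ℝ e).smulRight e

theorem radialScaling_apply (e : ℂ) (q : ℝ) (v : ℂ) :
    radialScaling e q v = v + (q - 1) • inner ℝ e v • e := by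
  simp [radialScaling]

section UnitVector

variable {e : ℂ} (he : ‖e‖ = 1)
include he

theorem norm_sq_radialScaling (q : ℝ) (v : ℂ) :
    ‖radialScaling e q v‖ ^ 2 = ‖v‖ ^ 2 - (1 - q ^ 2) * (inner ℝ e v) ^ 2 := by
  rw [radialScaling_apply, norm_add_sq_real, smul_smul, inner_smul_right, norm_smul, he,
    real_inner_comm, mul_one, Real.norm_eq_abs, sq_abs]
  ring

theorem det_radialScaling (q : ℝ) : (radialScaling e q).det = q := by
  have hcoord : e.re ^ 2 + e.im ^ 2 = 1 := by
    rw [← Complex.normSq_add_mul_I, Complex.re_add_im, Complex.normSq_eq_norm_sq, he, one_pow]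
  rw [ContinuousLinearMap.det, ← LinearMap.det_toMatrix Complex.basisOneI, Matrix.det_fin_two]
  simp only [Fin.isValue, LinearMap.toMatrix_apply, Complex.coe_basisOneI, Nat.succ_eq_add_one,
    Nat.reduceAdd, Matrix.cons_val_zero, ContinuousLinearMap.coe_coe, radialScaling_apply,
    Complex.inner, one_mul, Complex.conj_re, Complex.real_smul, Complex.ofReal_sub,
    Complex.ofReal_one, map_add, Finsupp.coe_add, Complex.coe_basisOneI_repr, Complex.one_re,
    Complex.one_im, Complex.mul_re, Complex.sub_re, Complex.ofReal_re, Complex.ofReal_im, zero_mul,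
    sub_zero, Complex.sub_im, sub_self, Complex.mul_im, add_zero, Pi.add_apply, Matrix.cons_val_one,
    Matrix.cons_val_fin_one, Complex.I_re, Complex.I_im, Complex.conj_im, mul_neg, sub_neg_eq_add,
    zero_add]
  linear_combination (q - 1) * hcoord

theorem norm_radialScaling_apply_le {q : ℝ} (hq0 : 0 ≤ q) (hq1 : q ≤ 1) (v : ℂ) :
    ‖radialScaling e q v‖ ≤ ‖v‖ := by
  refine le_of_sq_le_sq ?_ (norm_nonneg _)
  rw [norm_sq_radialScaling he]
  nlinarith [mul_nonneg (sub_nonneg.2 (pow_le_one₀ (n := 2) hq0 hq1)) (sq_nonneg (inner ℝ e v))]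

theorem mul_norm_le_norm_radialScaling_apply {q : ℝ} (hq0 : 0 ≤ q) (hq1 : q ≤ 1) (v : ℂ) :
    q * ‖v‖ ≤ ‖radialScaling e q v‖ := by
  have hinner : (inner ℝ e v) ^ 2 ≤ ‖v‖ ^ 2 := by
    rw [sq_le_sq, abs_norm]
    simpa [he] using abs_real_inner_le_norm e v
  refine le_of_sq_le_sq ?_ (norm_nonneg _)
  rw [norm_sq_radialScaling he, mul_pow]
  nlinarith [mul_nonneg (sub_nonneg.2 (pow_le_one₀ (n := 2) hq0 hq1)) (sub_nonneg.2 hinner)]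

theorem hasDistortion_radialScaling {K : ℝ} (hK : 1 ≤ K) :
    HasDistortion K (radialScaling e K⁻¹) := by
  have hK0 : 0 < K := one_pos.trans_le hK
  have hq0 : 0 ≤ K⁻¹ := inv_nonneg.2 hK0.le
  have hq1 : K⁻¹ ≤ 1 := inv_le_one_of_one_le₀ hK
  refine ⟨by rwa [det_radialScaling he], ?_, fun v w hv hw ↦ ?_⟩
  · rw [det_radialScaling he, mul_inv_cancel₀ hK0.ne']
    refine pow_le_one₀ (norm_nonneg _) ?_
    refine ContinuousLinearMap.opNorm_le_bound _ zero_le_one fun v ↦ ?_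
    rw [one_mul]
    exact norm_radialScaling_apply_le he hq0 hq1 v
  · calc
      ‖radialScaling e K⁻¹ v‖ ≤ ‖v‖ := norm_radialScaling_apply_le he hq0 hq1 v
      _ = K * (K⁻¹ * ‖w‖) := by rw [hv, hw, mul_one, mul_inv_cancel₀ hK0.ne']
      _ ≤ K * ‖radialScaling e K⁻¹ w‖ := by
        gcongr
        exact mul_norm_le_norm_radialScaling_apply he hq0 hq1 w

theorem one_le_norm_radialScaling (q : ℝ) : 1 ≤ ‖radialScaling e q‖ := by
  have horth : inner ℝ e (Complex.I * e) = (0 : ℝ) := by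
    simp only [Complex.inner, Complex.mul_re, Complex.I_re, zero_mul, Complex.I_im, one_mul,
      zero_sub, Complex.conj_re, neg_mul, Complex.mul_im, zero_add, Complex.conj_im, mul_neg,
      sub_neg_eq_add]
    ring
  have hfix : radialScaling e q (Complex.I * e) = Complex.I * e := by
    simp [radialScaling_apply, horth]
  simpa [hfix, he] using (radialScaling e q).le_opNorm (Complex.I * e)

end UnitVector

end Distortion

/-- A homeomorphism of the plane which is the identity off the open unit disc. -/
structure DiscHomeo extends ℂ ≃ₜ ℂ where
  apply_of_one_le : ∀ z, 1 ≤ ‖z‖ → toHomeomorph z = z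

namespace DiscHomeo

noncomputable instance : CoeFun DiscHomeo fun _ ↦ ℂ → ℂ := ⟨fun g ↦ g.toHomeomorph⟩

/-- The identity. -/
noncomputable def refl : DiscHomeo := ⟨Homeomorph.refl ℂ, fun _ _ ↦ rfl⟩

/-- The inverse homeomorphism. -/
noncomputable def symm (g : DiscHomeo) : DiscHomeo :=
  ⟨g.toHomeomorph.symm, fun z hz ↦ g.toHomeomorph.symm_apply_eq.2 (g.apply_of_one_le z hz).symm⟩

/-- The composition `h ∘ g`. -/
noncomputable def trans (g h : DiscHomeo) : DiscHomeo :=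
  ⟨g.toHomeomorph.trans h.toHomeomorph, fun z hz ↦ by
    rw [Homeomorph.trans_apply, g.apply_of_one_le z hz, h.apply_of_one_le z hz]⟩

theorem norm_apply_lt_one (g : DiscHomeo) {z : ℂ} (hz : ‖z‖ < 1) : ‖g z‖ < 1 := by
  by_contra! hgz
  rw [g.injective (g.apply_of_one_le _ hgz)] at hgz
  exact hgz.not_gt hz

theorem norm_apply_le_one (g : DiscHomeo) {z : ℂ} (hz : ‖z‖ ≤ 1) : ‖g z‖ ≤ 1 := by
  rcases hz.lt_or_eq with hz | hz
  · exact (g.norm_apply_lt_one hz).le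
  · rw [g.apply_of_one_le z hz.ge, hz]

theorem norm_apply_le_max (g : DiscHomeo) (z : ℂ) : ‖g z‖ ≤ max ‖z‖ 1 := by
  rcases le_total ‖z‖ 1 with hz | hz
  · exact le_max_of_le_right (g.norm_apply_le_one hz)
  · rw [g.apply_of_one_le z hz]
    exact le_max_left _ _

end DiscHomeo

section RadialStretch

/-- The radial map equal to the identity off the unit disc, to `z ↦ ‖z‖ ^ (q - 1) • z` on the
annulus `a ≤ ‖z‖ ≤ 1`, and to a similarity on the disc of radius `a`. -/
noncomputable def radialStretch (a q : ℝ) (z : ℂ) : ℂ :=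
  max a (min ‖z‖ 1) ^ (q - 1) • z

variable {a q : ℝ}

theorem radialStretch_of_norm_le (ha1 : a ≤ 1) {z : ℂ} (hz : ‖z‖ ≤ a) :
    radialStretch a q z = a ^ (q - 1) • z := by
  rw [radialStretch, min_eq_left (hz.trans ha1), max_eq_left hz]

theorem radialStretch_of_mem_annulus {z : ℂ} (hz : a ≤ ‖z‖) (hz1 : ‖z‖ ≤ 1) :
    radialStretch a q z = ‖z‖ ^ (q - 1) • z := by
  rw [radialStretch, min_eq_left hz1, max_eq_right hz]

theorem radialStretch_of_one_le (ha1 : a ≤ 1) {z : ℂ} (hz : 1 ≤ ‖z‖) :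
    radialStretch a q z = z := by
  rw [radialStretch, min_eq_right hz, max_eq_right ha1, Real.one_rpow, one_smul]

theorem norm_radialStretch_of_mem_annulus (ha : 0 < a) {z : ℂ} (hz : a ≤ ‖z‖) (hz1 : ‖z‖ ≤ 1) :
    ‖radialStretch a q z‖ = ‖z‖ ^ q := by
  have hz0 : 0 < ‖z‖ := ha.trans_le hz
  rw [radialStretch_of_mem_annulus hz hz1, norm_smul, Real.norm_of_nonneg (by positivity),
    ← Real.rpow_add_one hz0.ne', sub_add_cancel]

theorem continuous_radialStretch (ha : 0 < a) : Continuous (radialStretch a q) := by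
  refine Continuous.smul (Continuous.rpow_const (by fun_prop) fun z ↦ Or.inl ?_) continuous_id
  exact (lt_max_of_lt_left ha).ne'

theorem radialStretch_radialStretch (ha : 0 < a) (ha1 : a ≤ 1) (hq : 0 < q) (z : ℂ) :
    radialStretch (a ^ q) q⁻¹ (radialStretch a q z) = z := by
  have haq : a ^ q ≤ 1 := Real.rpow_le_one ha.le ha1 hq.le
  have hmul : q * (q⁻¹ - 1) = 1 - q := by field_simp
  rcases le_total 1 ‖z‖ with hz1 | hz1
  · rw [radialStretch_of_one_le ha1 hz1, radialStretch_of_one_le haq hz1]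
  rcases le_total a ‖z‖ with hza | hza
  · have hz0 : 0 < ‖z‖ := ha.trans_le hza
    have hnorm := norm_radialStretch_of_mem_annulus (q := q) ha hza hz1
    rw [radialStretch_of_mem_annulus (a := a ^ q) (by rw [hnorm]; gcongr)
        (hnorm.trans_le (Real.rpow_le_one hz0.le hz1 hq.le)), hnorm,
      radialStretch_of_mem_annulus hza hz1, ← Real.rpow_mul hz0.le, hmul, smul_smul,
      ← Real.rpow_add hz0]
    simp
  · have hnorm : ‖radialStretch a q z‖ ≤ a ^ q := by
      rw [radialStretch_of_norm_le ha1 hza, norm_smul, Real.norm_of_nonneg (by positivity)]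
      calc a ^ (q - 1) * ‖z‖ ≤ a ^ (q - 1) * a := by gcongr
        _ = a ^ q := by rw [← Real.rpow_add_one ha.ne', sub_add_cancel]
    rw [radialStretch_of_norm_le haq hnorm, radialStretch_of_norm_le ha1 hza,
      ← Real.rpow_mul ha.le, hmul, smul_smul, ← Real.rpow_add ha]
    simp

/-- `radialStretch a q` as a homeomorphism; its inverse is the stretch with exponent `q⁻¹`. -/
noncomputable def radialStretchHomeo (ha : 0 < a) (ha1 : a ≤ 1) (hq : 0 < q) : DiscHomeo where
  toFun := radialStretch a q
  invFun := radialStretch (a ^ q) q⁻¹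
  left_inv := radialStretch_radialStretch ha ha1 hq
  right_inv z := by
    have hinv := radialStretch_radialStretch (Real.rpow_pos_of_pos ha q)
      (Real.rpow_le_one ha.le ha1 hq.le) (inv_pos.2 hq) z
    rwa [← Real.rpow_mul ha.le, mul_inv_cancel₀ hq.ne', Real.rpow_one, inv_inv] at hinv
  continuous_toFun := continuous_radialStretch ha
  continuous_invFun := continuous_radialStretch (Real.rpow_pos_of_pos ha q)
  apply_of_one_le _ hz := radialStretch_of_one_le ha1 hz

theorem exists_lipschitzWith_clamp_rpow (ha : 0 < a) (ha1 : a ≤ 1) (p : ℝ) :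
    ∃ C, LipschitzWith C fun x : ℝ ↦ max a (min x 1) ^ p := by
  have hdiff : ContDiffOn ℝ 1 (fun x : ℝ ↦ x ^ p) (Icc a 1) := fun x hx ↦
    (Real.contDiffAt_rpow_const_of_ne (ha.trans_le hx.1).ne').contDiffWithinAt
  obtain ⟨C, hC⟩ := hdiff.exists_lipschitzOnWith one_ne_zero (convex_Icc a 1) isCompact_Icc
  have hclamp : LipschitzWith 1 fun x : ℝ ↦ max a (min x 1) :=
    (LipschitzWith.id.min_const 1).const_max a
  refine ⟨C * 1, lipschitzOnWith_univ.1 (hC.comp hclamp.lipschitzOnWith fun x _ ↦ ?_)⟩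
  exact ⟨le_max_left _ _, max_le ha1 (min_le_right _ _)⟩

theorem exists_lipschitzWith_radialStretch (ha : 0 < a) (ha1 : a ≤ 1) :
    ∃ C, LipschitzWith C (radialStretch a q) := by
  obtain ⟨C, hC⟩ := exists_lipschitzWith_clamp_rpow ha ha1 (q - 1)
  set g : ℝ → ℝ := fun x ↦ max a (min x 1) ^ (q - 1)
  have hg_one (x : ℝ) (hx : 1 ≤ x) : g x = 1 := by simp [g, hx, ha1]
  have hg_sub (z w : ℂ) : |g ‖z‖ - g ‖w‖| ≤ C * ‖z - w‖ := by
    rw [← Real.norm_eq_abs]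
    exact (hC.norm_sub_le _ _).trans (by gcongr; exact abs_norm_sub_norm_le z w)
  have hg_le (w : ℂ) : |g ‖w‖| ≤ 1 + C := by
    rcases le_total 1 ‖w‖ with hw | hw
    · simp [hg_one _ hw]
    · have hdist : |g ‖w‖ - 1| ≤ C := by
        have := hC.norm_sub_le ‖w‖ 1
        rw [hg_one 1 le_rfl, Real.norm_eq_abs, Real.norm_eq_abs] at this
        refine this.trans (mul_le_of_le_one_right C.2 ?_)
        exact abs_le.2 ⟨by linarith [norm_nonneg w], by linarith⟩
      calc |g ‖w‖| = |1 + (g ‖w‖ - 1)| := by ring_nf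
        _ ≤ 1 + C := (abs_add_le _ _).trans (by rw [abs_one]; gcongr)
  have hball (z w : ℂ) (hz : ‖z‖ ≤ 1) :
      ‖radialStretch a q z - radialStretch a q w‖ ≤ (1 + 2 * C) * ‖z - w‖ := by
    have hsplit : radialStretch a q z - radialStretch a q w
        = g ‖w‖ • (z - w) + (g ‖z‖ - g ‖w‖) • z := by
      simp only [radialStretch, g]
      module
    calc _ ≤ |g ‖w‖| * ‖z - w‖ + |g ‖z‖ - g ‖w‖| * ‖z‖ := by
          rw [hsplit]
          exact (norm_add_le _ _).trans_eq (by simp only [norm_smul, Real.norm_eq_abs])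
      _ ≤ (1 + C) * ‖z - w‖ + C * ‖z - w‖ * 1 := by gcongr; exacts [hg_le w, hg_sub z w]
      _ = _ := by ring
  refine ⟨1 + 2 * C, LipschitzWith.of_dist_le_mul fun z w ↦ ?_⟩
  rw [dist_eq_norm, dist_eq_norm]
  push_cast
  rcases le_total ‖z‖ 1 with hz | hz
  · exact hball z w hz
  rcases le_total ‖w‖ 1 with hw | hw
  · rw [norm_sub_rev, norm_sub_rev z]
    exact hball w z hw
  · rw [radialStretch_of_one_le ha1 hz, radialStretch_of_one_le ha1 hw]
    nlinarith [norm_nonneg (z - w), C.2]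

theorem hasFDerivAt_norm_rpow_smul (q : ℝ) {z : ℂ} (hz : z ≠ 0) :
    HasFDerivAt (fun z : ℂ ↦ ‖z‖ ^ (q - 1) • z)
      (‖z‖ ^ (q - 1) • radialScaling (‖z‖⁻¹ • z) q) z := by
  have hz0 : 0 < ‖z‖ := norm_pos_iff.2 hz
  have hrpow (w : ℂ) : (‖w‖ ^ 2) ^ ((q - 1) / 2) = ‖w‖ ^ (q - 1) := by
    rw [← Real.rpow_natCast, ← Real.rpow_mul (norm_nonneg _)]
    congr 1
    push_cast
    ring
  have hrpow' : (‖z‖ ^ 2) ^ ((q - 1) / 2 - 1) = ‖z‖ ^ (q - 1) * ‖z‖⁻¹ ^ 2 := by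
    rw [Real.rpow_sub (by positivity), hrpow, Real.rpow_one, div_eq_mul_inv, inv_pow]
  have hderiv := (((hasStrictFDerivAt_norm_sq z).hasFDerivAt.rpow_const (p := (q - 1) / 2)
    (Or.inl (by positivity))).smul (hasFDerivAt_id z))
  simp only [hrpow] at hderiv
  refine HasFDerivAt.congr_fderiv hderiv ?_
  ext1 v
  rw [hrpow']
  simp only [smul_apply, radialScaling_apply, add_apply,
    ContinuousLinearMap.smulRight_apply, inner_smul_left, ContinuousLinearMap.id_apply, id,
    innerSL_apply_apply, nsmul_eq_mul, smul_eq_mul, conj_trivial, smul_smul, smul_add]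
  congr 2
  push_cast
  ring

theorem hasDistortion_fderiv_radialStretch {K : ℝ} (hK : 1 ≤ K) (ha : 0 < a) (ha1 : a ≤ 1) {z : ℂ}
    (hza : ‖z‖ ≠ a) (hz1 : ‖z‖ ≠ 1) :
    HasDistortion K (fderiv ℝ (radialStretch a K⁻¹) z) ∧
      1 ≤ ‖fderiv ℝ (radialStretch a K⁻¹) z‖ := by
  have hq : K⁻¹ - 1 ≤ 0 := sub_nonpos.2 (inv_le_one_of_one_le₀ hK)
  rcases lt_or_gt_of_ne hza with hza | hza
  · have hnear : radialStretch a K⁻¹ =ᶠ[𝓝 z] fun w ↦ a ^ (K⁻¹ - 1) • w := by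
      filter_upwards [continuous_norm.continuousAt.eventually_lt_const hza] with w hw
      exact radialStretch_of_norm_le ha1 hw.le
    rw [hnear.fderiv_eq, fderiv_fun_const_smul differentiableAt_fun_id, fderiv_fun_id]
    refine ⟨(hasDistortion_id hK).smul _, ?_⟩
    rw [norm_smul, ContinuousLinearMap.norm_id, mul_one, Real.norm_of_nonneg (by positivity)]
    exact Real.one_le_rpow_of_pos_of_le_one_of_nonpos ha ha1 hq
  rcases lt_or_gt_of_ne hz1 with hz1 | hz1
  · have hz0 : 0 < ‖z‖ := ha.trans hza
    have hunit : ‖(‖z‖⁻¹ • z)‖ = 1 := by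
      rw [norm_smul, norm_inv, norm_norm, inv_mul_cancel₀ hz0.ne']
    have hnear : radialStretch a K⁻¹ =ᶠ[𝓝 z] fun w ↦ ‖w‖ ^ (K⁻¹ - 1) • w := by
      filter_upwards [continuous_norm.continuousAt.eventually_lt_const hz1,
        continuous_norm.continuousAt.eventually_const_lt hza] with w hw hw'
      exact radialStretch_of_mem_annulus hw'.le hw.le
    rw [hnear.fderiv_eq, (hasFDerivAt_norm_rpow_smul K⁻¹ (norm_pos_iff.1 hz0)).fderiv]
    refine ⟨(hasDistortion_radialScaling hunit hK).smul _, ?_⟩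
    rw [norm_smul, Real.norm_of_nonneg (by positivity)]
    exact one_le_mul_of_one_le_of_one_le
      (Real.one_le_rpow_of_pos_of_le_one_of_nonpos hz0 hz1.le hq)
      (one_le_norm_radialScaling hunit _)
  · have hnear : radialStretch a K⁻¹ =ᶠ[𝓝 z] fun w ↦ w := by
      filter_upwards [continuous_norm.continuousAt.eventually_const_lt hz1] with w hw
      exact radialStretch_of_one_le ha1 hw.le
    rw [hnear.fderiv_eq, fderiv_fun_id]
    exact ⟨hasDistortion_id hK, by simp⟩

theorem ae_hasDistortion_fderiv_radialStretch {K : ℝ} (hK : 1 ≤ K) (ha : 0 < a) (ha1 : a ≤ 1) :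
    ∀ᵐ z, HasDistortion K (fderiv ℝ (radialStretch a K⁻¹) z) ∧
      1 ≤ ‖fderiv ℝ (radialStretch a K⁻¹) z‖ := by
  filter_upwards [measure_eq_zero_iff_ae_notMem.1 (Measure.addHaar_sphere volume (0 : ℂ) a),
    measure_eq_zero_iff_ae_notMem.1 (Measure.addHaar_sphere volume (0 : ℂ) 1)] with z hza hz1
  rw [mem_sphere_zero_iff_norm] at hza hz1
  exact hasDistortion_fderiv_radialStretch hK ha ha1 hza hz1

end RadialStretch

section QuasiconformalApproximation

theorem memL2Loc_of_continuous {f : ℂ → ℂ} (hf : Continuous f) : MemL2Loc f := by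
  intro S hS
  have : IsFiniteMeasure (volume.restrict S) := ⟨by simpa using hS.measure_lt_top⟩
  obtain ⟨C, hC⟩ := hS.exists_bound_of_continuousOn hf.continuousOn
  exact MemLp.of_bound hf.aestronglyMeasurable C
    ((ae_restrict_iff' hS.measurableSet).2 (Eventually.of_forall hC))

theorem lintegral_enorm_fderiv_sq_le {K : ℝ} (hK : 0 ≤ K) {f : ℂ → ℂ}
    (hdiff : ∀ᵐ z, DifferentiableAt ℝ f z) (hinj : Function.Injective f)
    (hdist : ∀ᵐ z, HasDistortion K (fderiv ℝ f z)) {S T : Set ℂ} (hS : MeasurableSet S)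
    (hST : MapsTo f S T) :
    ∫⁻ z in S, ‖fderiv ℝ f z‖ₑ ^ (2 : ℝ) ≤ ENNReal.ofReal K * volume T := by
  set U := S ∩ {z | DifferentiableAt ℝ f z}
  have hU : MeasurableSet U := hS.inter (measurableSet_of_differentiableAt ℝ f)
  have hUS : U =ᵐ[volume] S := inter_ae_eq_left_of_ae_eq_univ (eventuallyEq_univ.2 hdiff)
  rw [← setLIntegral_congr hUS]
  calc ∫⁻ z in U, ‖fderiv ℝ f z‖ₑ ^ (2 : ℝ)
      ≤ ∫⁻ z in U, ENNReal.ofReal K * ENNReal.ofReal |(fderiv ℝ f z).det| := by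
        refine lintegral_mono_ae ?_
        filter_upwards [ae_restrict_of_ae hdist] with z hz
        rw [← ENNReal.ofReal_mul hK, abs_of_nonneg hz.det_nonneg, ← ofReal_norm,
          ENNReal.ofReal_rpow_of_nonneg (norm_nonneg _) zero_le_two]
        exact ENNReal.ofReal_le_ofReal (by exact_mod_cast hz.norm_sq_le)
    _ = ENNReal.ofReal K * ∫⁻ z in U, ENNReal.ofReal |(fderiv ℝ f z).det| :=
        lintegral_const_mul' _ _ ENNReal.ofReal_ne_top
    _ = ENNReal.ofReal K * volume (f '' U) := by
        rw [lintegral_abs_det_fderiv_eq_addHaar_image volume hU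
          (fun x hx ↦ (DifferentiableAt.hasFDerivAt hx.2).hasFDerivWithinAt) hinj.injOn]
    _ ≤ _ := by
        gcongr
        exact (image_mono inter_subset_left).trans hST.image_subset

section IntegrationByParts

variable {ψ : ℂ → ℝ} (hψ : ContDiff ℝ ∞ ψ) (hψc : HasCompactSupport ψ) (v : ℂ)
include hψ

theorem continuous_fderiv_apply_of_contDiff : Continuous fun z ↦ fderiv ℝ ψ z v :=
  (hψ.continuous_fderiv (by simp)).clm_apply continuous_const

include hψc

theorem integral_fderiv_smul_eq_of_lipschitzWith_real {L : ℝ≥0} {f : ℂ → ℝ}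
    (hf : LipschitzWith L f) :
    ∫ z, fderiv ℝ ψ z v * f z = -∫ z, ψ z * fderiv ℝ f z v := by
  obtain ⟨D, hD⟩ :=
    (hψ.of_le (mod_cast le_top)).lipschitzWith_of_hasCompactSupport hψc one_ne_zero
  have hline : ∫ z, lineDeriv ℝ f z v * ψ z = ∫ z, ψ z * fderiv ℝ f z v := by
    refine integral_congr_ae ?_
    filter_upwards [hf.ae_differentiableAt] with z hz
    rw [hz.lineDeriv_eq_fderiv, mul_comm]
  have hline' : ∫ z, lineDeriv ℝ ψ z (-v) * f z = -∫ z, fderiv ℝ ψ z v * f z := by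
    rw [← integral_neg]
    refine integral_congr_ae (Eventually.of_forall fun z ↦ ?_)
    simp only [((hψ.differentiable (by simp)) z).lineDeriv_eq_fderiv, map_neg, neg_mul]
  rw [← hline, hf.integral_lineDeriv_mul_eq hD hψc v, hline', neg_neg]

theorem integral_fderiv_smul_eq_of_lipschitzWith {L : ℝ≥0} {f : ℂ → ℂ} (hf : LipschitzWith L f) :
    ∫ z, fderiv ℝ ψ z v • f z = -∫ z, ψ z • fderiv ℝ f z v := by
  have hint : Integrable fun z ↦ fderiv ℝ ψ z v • f z :=
    ((continuous_fderiv_apply_of_contDiff hψ v).smul hf.continuous).integrable_of_hasCompactSupport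
      (hψc.fderiv_apply ℝ v).smul_right
  have hint' : Integrable fun z ↦ ψ z • fderiv ℝ f z v := by
    refine Integrable.smul_of_top_left (φ := ψ)
      (hψ.continuous.integrable_of_hasCompactSupport (μ := volume) hψc) ?_
    refine memLp_top_of_bound (measurable_fderiv_apply_const ℝ f v).aestronglyMeasurable
      (L * ‖v‖) (Eventually.of_forall fun z ↦ ?_)
    exact ((fderiv ℝ f z).le_opNorm v).trans (by gcongr; exact norm_fderiv_le_of_lipschitz ℝ hf)
  have hcoord (l : ℂ →L[ℝ] ℝ) :
      l (∫ z, fderiv ℝ ψ z v • f z) = l (-∫ z, ψ z • fderiv ℝ f z v) := by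
    rw [map_neg, ← l.integral_comp_comm hint, ← l.integral_comp_comm hint']
    simp only [map_smul, smul_eq_mul]
    refine (integral_fderiv_smul_eq_of_lipschitzWith_real hψ hψc v (l.lipschitz.comp hf)).trans ?_
    congr 1
    refine integral_congr_ae ?_
    filter_upwards [hf.ae_differentiableAt] with z hz
    rw [fderiv_comp z l.differentiableAt hz, l.fderiv, ContinuousLinearMap.comp_apply]
  exact Complex.ext (hcoord Complex.reCLM) (hcoord Complex.imCLM)

end IntegrationByParts

/-- `φ` is approximated by Lipschitz homeomorphisms `f n` of distortion `K` whose differentials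
increase in norm and which stabilize to `φ` near almost every point. -/
structure IsQCApprox (K : ℝ) (f : ℕ → DiscHomeo) (φ : DiscHomeo) : Prop where
  lipschitz : ∀ n, ∃ L, LipschitzWith L (f n)
  distortion : ∀ n, ∀ᵐ z, HasDistortion K (fderiv ℝ (f n) z)
  norm_mono : ∀ n, ∀ᵐ z, ‖fderiv ℝ (f n) z‖ ≤ ‖fderiv ℝ (f (n + 1)) z‖
  eventuallyEq : ∀ᵐ z, ∃ N, ∀ n ≥ N, f n =ᶠ[𝓝 z] φ

namespace IsQCApprox

variable {K : ℝ} {f : ℕ → DiscHomeo} {φ : DiscHomeo} (h : IsQCApprox K f φ)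
include h

theorem ae_exists_fderiv_eq : ∀ᵐ z, ∃ N, ∀ n ≥ N, fderiv ℝ (f n) z = fderiv ℝ φ z := by
  filter_upwards [h.eventuallyEq] with z ⟨N, hN⟩
  exact ⟨N, fun n hn ↦ (hN n hn).fderiv_eq⟩

theorem ae_tendsto_fderiv :
    ∀ᵐ z, Tendsto (fun n ↦ fderiv ℝ (f n) z) atTop (𝓝 (fderiv ℝ φ z)) := by
  filter_upwards [h.ae_exists_fderiv_eq] with z ⟨N, hN⟩
  exact tendsto_const_nhds.congr' ((eventually_ge_atTop N).mono fun n hn ↦ (hN n hn).symm)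

theorem ae_norm_fderiv_le : ∀ᵐ z, ∀ n, ‖fderiv ℝ (f n) z‖ ≤ ‖fderiv ℝ φ z‖ := by
  filter_upwards [h.ae_exists_fderiv_eq, ae_all_iff.2 h.norm_mono] with z ⟨N, hN⟩ hmono n
  rw [← hN (max N n) (le_max_left _ _)]
  exact monotone_nat_of_le_succ hmono (le_max_right _ _)

theorem ae_hasDistortion : ∀ᵐ z, HasDistortion K (fderiv ℝ φ z) := by
  filter_upwards [h.ae_exists_fderiv_eq, ae_all_iff.2 h.distortion] with z ⟨N, hN⟩ hdist
  exact hN N le_rfl ▸ hdist N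

theorem memL2Loc_fderiv (hK : 0 ≤ K) : MemL2Loc fun z ↦ fderiv ℝ φ z := by
  intro S hS
  obtain ⟨ρ, hρ⟩ := hS.isBounded.subset_closedBall 0
  set B := ENNReal.ofReal K * volume (closedBall (0 : ℂ) (max ρ 1))
  have hB : B < ⊤ := ENNReal.mul_lt_top ENNReal.ofReal_lt_top measure_closedBall_lt_top
  have henergy (n : ℕ) :
      eLpNorm (fun z ↦ fderiv ℝ (f n) z) 2 (volume.restrict S) ≤ B ^ (1 / 2 : ℝ) := by
    rw [eLpNorm_eq_lintegral_rpow_enorm_toReal two_ne_zero ENNReal.ofNat_ne_top]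
    simp only [ENNReal.toReal_ofNat]
    gcongr
    obtain ⟨L, hL⟩ := h.lipschitz n
    refine lintegral_enorm_fderiv_sq_le hK hL.ae_differentiableAt (f n).injective (h.distortion n)
      hS.measurableSet fun z hz ↦ mem_closedBall_zero_iff.2 ?_
    exact ((f n).norm_apply_le_max z).trans
      (max_le_max_right 1 (mem_closedBall_zero_iff.1 (hρ hz)))
  have hliminf := Lp.eLpNorm_lim_le_liminf_eLpNorm (p := 2) (μ := volume.restrict S)
    (fun n ↦ (measurable_fderiv ℝ (f n)).aestronglyMeasurable) _
    (ae_restrict_of_ae h.ae_tendsto_fderiv)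
  refine ⟨(measurable_fderiv ℝ φ).aestronglyMeasurable, hliminf.trans_lt ?_⟩
  refine (liminf_le_of_le (by isBoundedDefault) fun b hb ↦ ?_).trans_lt
    (ENNReal.rpow_lt_top_of_nonneg (y := 1 / 2) (by norm_num) hB.ne)
  obtain ⟨n, hn⟩ := hb.exists
  exact hn.trans (henergy n)

variable {ψ : ℂ → ℝ} (hψ : ContDiff ℝ ∞ ψ) (hψc : HasCompactSupport ψ) (v : ℂ)
include hψ hψc

theorem tendsto_integral_fderiv_smul :
    Tendsto (fun n ↦ ∫ z, fderiv ℝ ψ z v • f n z) atTop (𝓝 (∫ z, fderiv ℝ ψ z v • φ z)) := by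
  have hcont := continuous_fderiv_apply_of_contDiff hψ v
  refine tendsto_integral_of_dominated_convergence (fun z ↦ ‖fderiv ℝ ψ z v‖ * max ‖z‖ 1)
    (fun n ↦ (hcont.smul (f n).continuous).aestronglyMeasurable) ?_
    (fun n ↦ Eventually.of_forall fun z ↦ ?_) ?_
  · exact Continuous.integrable_of_hasCompactSupport (by fun_prop)
      (hψc.fderiv_apply ℝ v).norm.mul_right
  · rw [norm_smul]
    gcongr
    exact (f n).norm_apply_le_max z
  · filter_upwards [h.eventuallyEq] with z ⟨N, hN⟩
    refine tendsto_const_nhds.congr' ((eventually_ge_atTop N).mono fun n hn ↦ ?_)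
    simp only [(hN n hn).eq_of_nhds]

theorem tendsto_integral_smul_fderiv (hK : 0 ≤ K) :
    Tendsto (fun n ↦ ∫ z, ψ z • fderiv ℝ (f n) z v) atTop (𝓝 (∫ z, ψ z • fderiv ℝ φ z v)) := by
  refine tendsto_integral_of_dominated_convergence (fun z ↦ ‖ψ z‖ * (‖fderiv ℝ φ z‖ * ‖v‖))
    (fun n ↦ hψ.continuous.aestronglyMeasurable.smul
      (measurable_fderiv_apply_const ℝ (f n) v).aestronglyMeasurable) ?_ (fun n ↦ ?_) ?_
  · have hcompact : IsCompact (tsupport ψ) := hψc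
    have : IsFiniteMeasure (volume.restrict (tsupport ψ)) :=
      ⟨by simpa using hcompact.measure_lt_top⟩
    obtain ⟨M, hM⟩ := hψ.continuous.bounded_above_of_compact_support hψc
    rw [← integrableOn_iff_integrable_of_support_subset (s := tsupport ψ) fun z hz ↦
      subset_tsupport _ fun hψz ↦ hz (by simp [hψz])]
    refine (((h.memL2Loc_fderiv hK _ hcompact).integrable one_le_two).norm.mul_const ‖v‖).bdd_mul
      (c := M) hψ.continuous.norm.aestronglyMeasurable (Eventually.of_forall fun z ↦ ?_)
    simpa using hM z
  · filter_upwards [h.ae_norm_fderiv_le] with z hz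
    rw [norm_smul]
    gcongr
    exact ((fderiv ℝ (f n) z).le_opNorm v).trans (by gcongr; exact hz n)
  · filter_upwards [h.ae_tendsto_fderiv] with z hz
    exact (((ContinuousLinearMap.apply ℝ ℂ v).continuous.tendsto _).comp hz).const_smul (ψ z)

omit hψ hψc

theorem isQuasiconformal (hK : 0 ≤ K) : IsQuasiconformal K φ.toHomeomorph := by
  refine ⟨fun z ↦ fderiv ℝ φ z, ⟨memL2Loc_of_continuous φ.continuous, h.memL2Loc_fderiv hK, ?_⟩,
    h.ae_hasDistortion.mono fun _ hz ↦ hz.det_nonneg,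
    h.ae_hasDistortion.mono fun _ hz ↦ hz.norm_apply_le⟩
  intro ψ hψ hψc v
  refine tendsto_nhds_unique (h.tendsto_integral_fderiv_smul hψ hψc v)
    ((h.tendsto_integral_smul_fderiv hψ hψc v hK).neg.congr fun n ↦ ?_)
  obtain ⟨L, hL⟩ := h.lipschitz n
  exact (integral_fderiv_smul_eq_of_lipschitzWith hψ hψc v hL).symm

end IsQCApprox

end QuasiconformalApproximation

section Topology

theorem isCompact_insert_iUnion {X ι : Type*} [TopologicalSpace X] {a : X} {S : ι → Set X}
    (hS : ∀ i, IsCompact (S i)) (hlim : Tendsto S cofinite (𝓝 a).smallSets) :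
    IsCompact (insert a (⋃ i, S i)) := by
  refine isCompact_of_finite_subcover fun {κ} U hU hcover ↦ ?_
  obtain ⟨k₀, hk₀⟩ := mem_iUnion.1 (hcover (mem_insert a _))
  have hfin : {i | ¬S i ⊆ U k₀}.Finite :=
    eventually_cofinite.1 ((tendsto_smallSets_iff.1 hlim) _ ((hU k₀).mem_nhds hk₀))
  have hcpt : IsCompact (⋃ i ∈ {i | ¬S i ⊆ U k₀}, S i) := hfin.isCompact_biUnion fun i _ ↦ hS i
  obtain ⟨t, ht⟩ := hcpt.elim_finite_subcover U hU <|
    (iUnion₂_subset fun i _ ↦ subset_iUnion S i).trans ((subset_insert _ _).trans hcover)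
  classical
  refine ⟨insert k₀ t, insert_subset (mem_iUnion₂.2 ⟨k₀, Finset.mem_insert_self _ _, hk₀⟩) ?_⟩
  refine iUnion_subset fun i ↦ ?_
  by_cases hi : S i ⊆ U k₀
  · exact hi.trans (subset_iUnion₂_of_subset k₀ (Finset.mem_insert_self _ _) subset_rfl)
  · exact (subset_iUnion₂_of_subset i hi subset_rfl).trans <| ht.trans <|
      biUnion_subset_biUnion_left fun k hk ↦ Finset.mem_insert_of_mem hk

end Topology

/-- A closed disc of positive radius in the plane. -/
structure Disc where
  center : ℂ
  radius : ℝ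
  radius_pos : 0 < radius

namespace Disc

/-- The set of points of the closed disc. -/
def carrier (D : Disc) : Set ℂ := closedBall D.center D.radius

/-- The similarity of the plane which maps the closed unit disc onto `D`. -/
noncomputable def chart (D : Disc) : ℂ ≃ₜ ℂ where
  toFun w := D.center + D.radius • w
  invFun z := D.radius⁻¹ • (z - D.center)
  left_inv w := by simp [D.radius_pos.ne']
  right_inv z := by simp [D.radius_pos.ne']
  continuous_toFun := by fun_prop
  continuous_invFun := by fun_prop

variable (D : Disc)

theorem chart_apply (w : ℂ) : D.chart w = D.center + D.radius • w := rfl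

theorem chart_symm_apply (z : ℂ) : D.chart.symm z = D.radius⁻¹ • (z - D.center) := rfl

theorem dist_chart (z w : ℂ) : dist (D.chart z) (D.chart w) = D.radius * dist z w := by
  rw [chart_apply, chart_apply, dist_add_left, dist_smul₀, Real.norm_of_nonneg D.radius_pos.le]

theorem norm_chart_symm (z : ℂ) : ‖D.chart.symm z‖ = dist z D.center / D.radius := by
  rw [chart_symm_apply, norm_smul, norm_inv, Real.norm_of_nonneg D.radius_pos.le, dist_eq_norm,
    inv_mul_eq_div]

theorem norm_chart_symm_le_one {z : ℂ} : ‖D.chart.symm z‖ ≤ 1 ↔ z ∈ D.carrier := by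
  rw [norm_chart_symm, div_le_one D.radius_pos, carrier, mem_closedBall]

theorem norm_chart_symm_lt_one {z : ℂ} : ‖D.chart.symm z‖ < 1 ↔ z ∈ ball D.center D.radius := by
  rw [norm_chart_symm, div_lt_one D.radius_pos, mem_ball]

theorem chart_mem_carrier {w : ℂ} : D.chart w ∈ D.carrier ↔ ‖w‖ ≤ 1 := by
  rw [← norm_chart_symm_le_one, Homeomorph.symm_apply_apply]

theorem isCompact_carrier : IsCompact D.carrier := isCompact_closedBall _ _

theorem ae_chart_symm {p : ℂ → Prop} (hp : ∀ᵐ w, p w) : ∀ᵐ z, p (D.chart.symm z) := by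
  have hsub : ∀ᵐ z, p (D.radius⁻¹ • z) := by
    rw [ae_iff] at hp ⊢
    change volume ((fun z : ℂ ↦ D.radius⁻¹ • z) ⁻¹' {w | ¬p w}) = 0
    rw [Measure.addHaar_preimage_smul _ (inv_ne_zero D.radius_pos.ne'), hp, mul_zero]
  exact (measurePreserving_sub_right volume D.center).quasiMeasurePreserving.ae hsub

theorem fderiv_chart_comp_chart_symm (D' : Disc) (g : ℂ → ℂ) (z : ℂ) :
    fderiv ℝ (fun z ↦ D'.chart (g (D.chart.symm z))) z
      = (D'.radius / D.radius) • fderiv ℝ g (D.chart.symm z) := by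
  simp only [chart_apply, chart_symm_apply]
  rw [fderiv_const_add]
  refine (congrFun (fderiv_const_smul_field D'.radius) z).trans ?_
  rw [Pi.smul_apply, fderiv_comp_sub (f := fun z ↦ g (D.radius⁻¹ • z)), fderiv_comp_smul, smul_smul,
    div_eq_mul_inv]

/-- The map `g` of the unit disc, transplanted to `D` by the chart. -/
noncomputable def conj (g : ℂ → ℂ) (z : ℂ) : ℂ := D.chart (g (D.chart.symm z))

theorem conj_chart (g : ℂ → ℂ) (w : ℂ) : D.conj g (D.chart w) = D.chart (g w) := by
  rw [conj, Homeomorph.symm_apply_apply]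

theorem fderiv_conj (g : ℂ → ℂ) (z : ℂ) :
    fderiv ℝ (D.conj g) z = fderiv ℝ g (D.chart.symm z) := by
  rw [show D.conj g = fun z ↦ D.chart (g (D.chart.symm z)) from rfl, fderiv_chart_comp_chart_symm,
    div_self D.radius_pos.ne', one_smul]

theorem continuous_conj {g : ℂ → ℂ} (hg : Continuous g) : Continuous (D.conj g) :=
  D.chart.continuous.comp (hg.comp D.chart.symm.continuous)

theorem conj_eventuallyEq {g h : ℂ → ℂ} {z : ℂ} (hgh : g =ᶠ[𝓝 (D.chart.symm z)] h) :
    D.conj g =ᶠ[𝓝 z] D.conj h :=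
  (D.chart.symm.continuous.continuousAt.eventually hgh).mono fun _ hw ↦ congrArg D.chart hw

theorem lipschitzWith_conj {L : ℝ≥0} {g : ℂ → ℂ} (hg : LipschitzWith L g) :
    LipschitzWith L (D.conj g) := by
  refine LipschitzWith.of_dist_le_mul fun z w ↦ ?_
  have hsymm : D.radius * dist (D.chart.symm z) (D.chart.symm w) = dist z w := by
    rw [← dist_chart, Homeomorph.apply_symm_apply, Homeomorph.apply_symm_apply]
  rw [conj, conj, dist_chart, ← hsymm, mul_left_comm]
  exact mul_le_mul_of_nonneg_left (hg.dist_le_mul _ _) D.radius_pos.le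

theorem conj_mem_carrier (g : DiscHomeo) {z : ℂ} (hz : z ∈ D.carrier) :
    D.conj g z ∈ D.carrier :=
  D.chart_mem_carrier.2 (g.norm_apply_le_one (D.norm_chart_symm_le_one.2 hz))

theorem conj_of_notMem_ball (g : DiscHomeo) {z : ℂ} (hz : z ∉ ball D.center D.radius) :
    D.conj g z = z := by
  rw [← norm_chart_symm_lt_one, not_lt] at hz
  rw [conj, g.apply_of_one_le _ hz, Homeomorph.apply_symm_apply]

theorem conj_of_notMem_carrier (g : DiscHomeo) {z : ℂ} (hz : z ∉ D.carrier) : D.conj g z = z :=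
  D.conj_of_notMem_ball g fun hball ↦ hz (ball_subset_closedBall hball)

end Disc

/-- A family of disjoint discs in the unit disc which, if it is infinite, shrinks to the origin. -/
structure DiscFamily (ι : Type*) where
  disc : ι → Disc
  norm_center_add_radius_le : ∀ i, ‖(disc i).center‖ + (disc i).radius ≤ 1
  pairwise_disjoint : Pairwise fun i j ↦ Disjoint (disc i).carrier (disc j).carrier
  tendsto_smallSets : Tendsto (fun i ↦ (disc i).carrier) cofinite (𝓝 0).smallSets

namespace DiscFamily

variable {ι : Type*} (𝒟 : DiscFamily ι)

theorem eq_of_mem_carrier {i j : ι} {z : ℂ} (hi : z ∈ (𝒟.disc i).carrier)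
    (hj : z ∈ (𝒟.disc j).carrier) : i = j := by
  by_contra hij
  exact disjoint_left.1 (𝒟.pairwise_disjoint hij) hi hj

theorem notMem_ball_of_one_le (i : ι) {z : ℂ} (hz : 1 ≤ ‖z‖) :
    z ∉ ball (𝒟.disc i).center (𝒟.disc i).radius := by
  intro hball
  have hdist := norm_le_norm_add_norm_sub' z (𝒟.disc i).center
  rw [mem_ball, dist_eq_norm] at hball
  linarith [𝒟.norm_center_add_radius_le i]

theorem isClosed_insert_iUnion_carrier : IsClosed (insert 0 (⋃ i, (𝒟.disc i).carrier)) :=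
  (isCompact_insert_iUnion (fun i ↦ (𝒟.disc i).isCompact_carrier) 𝒟.tendsto_smallSets).isClosed

theorem eventually_dist_lt {ε : ℝ} (hε : 0 < ε) :
    ∀ᶠ i in cofinite, ∀ z ∈ (𝒟.disc i).carrier, ∀ w ∈ (𝒟.disc i).carrier, dist z w < ε := by
  filter_upwards [tendsto_smallSets_iff.1 𝒟.tendsto_smallSets _ (ball_mem_nhds 0 (half_pos hε))]
    with i hi z hz w hw
  exact (dist_triangle_right z w 0).trans_lt
    ((add_lt_add (mem_ball.1 (hi hz)) (mem_ball.1 (hi hw))).trans_eq (add_halves ε))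

section Paste

/-- The map which acts as `g i` in the disc `i`, through its chart, and as the identity elsewhere.
At each point at most one term of the sum is nonzero. -/
noncomputable def pasteFun (g : ι → DiscHomeo) (z : ℂ) : ℂ :=
  z + ∑' i, ((𝒟.disc i).conj (g i) z - z)

variable (g : ι → DiscHomeo)

theorem pasteFun_of_mem {i : ι} {z : ℂ} (hz : z ∈ (𝒟.disc i).carrier) :
    𝒟.pasteFun g z = (𝒟.disc i).conj (g i) z := by
  rw [pasteFun, tsum_eq_single i fun j hji ↦ ?_, add_sub_cancel]
  rw [(𝒟.disc j).conj_of_notMem_carrier _ fun hj ↦ hji (𝒟.eq_of_mem_carrier hj hz), sub_self]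

theorem pasteFun_of_forall_notMem {z : ℂ} (hz : ∀ i, z ∉ (𝒟.disc i).carrier) :
    𝒟.pasteFun g z = z := by
  simp only [pasteFun, (𝒟.disc _).conj_of_notMem_carrier (g _) (hz _), sub_self, tsum_zero,
    add_zero]

theorem pasteFun_of_forall_notMem_ball {z : ℂ}
    (hz : ∀ i, z ∉ ball (𝒟.disc i).center (𝒟.disc i).radius) : 𝒟.pasteFun g z = z := by
  simp only [pasteFun, (𝒟.disc _).conj_of_notMem_ball (g _) (hz _), sub_self, tsum_zero, add_zero]

theorem pasteFun_symm_pasteFun (z : ℂ) :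
    𝒟.pasteFun (fun i ↦ (g i).symm) (𝒟.pasteFun g z) = z := by
  by_cases hz : ∃ i, z ∈ (𝒟.disc i).carrier
  · obtain ⟨i, hi⟩ := hz
    rw [𝒟.pasteFun_of_mem g hi, 𝒟.pasteFun_of_mem _ ((𝒟.disc i).conj_mem_carrier _ hi),
      Disc.conj, Disc.conj, Homeomorph.symm_apply_apply]
    exact (congrArg _ ((g i).symm_apply_apply _)).trans ((𝒟.disc i).chart.apply_symm_apply z)
  · push Not at hz
    rw [𝒟.pasteFun_of_forall_notMem g hz, 𝒟.pasteFun_of_forall_notMem _ hz]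

theorem continuous_pasteFun : Continuous (𝒟.pasteFun g) := by
  have hunif : TendstoUniformly (fun (s : Finset ι) z ↦ z + ∑ i ∈ s, ((𝒟.disc i).conj (g i) z - z))
      (𝒟.pasteFun g) atTop := by
    rw [Metric.tendstoUniformly_iff]
    intro ε hε
    have hfin := eventually_cofinite.1 (𝒟.eventually_dist_lt hε)
    filter_upwards [eventually_ge_atTop hfin.toFinset] with s hs z
    by_cases hz : ∃ i ∉ s, z ∈ (𝒟.disc i).carrier
    · obtain ⟨i, his, hi⟩ := hz
      have hzero : ∑ j ∈ s, ((𝒟.disc j).conj (g j) z - z) = 0 := Finset.sum_eq_zero fun j hj ↦ by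
        rw [(𝒟.disc j).conj_of_notMem_carrier, sub_self]
        exact fun hzj ↦ his (𝒟.eq_of_mem_carrier hi hzj ▸ hj)
      have hi_small : ∀ z ∈ (𝒟.disc i).carrier, ∀ w ∈ (𝒟.disc i).carrier, dist z w < ε := by
        by_contra hi_large
        exact his (hs (hfin.mem_toFinset.2 hi_large))
      rw [hzero, add_zero, 𝒟.pasteFun_of_mem g hi]
      exact hi_small _ ((𝒟.disc i).conj_mem_carrier _ hi) _ hi
    · push Not at hz
      rw [pasteFun, tsum_eq_sum fun i his ↦ ?_, dist_self]
      · exact hε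
      · rw [(𝒟.disc i).conj_of_notMem_carrier _ (hz i his), sub_self]
  refine hunif.continuous (Frequently.of_forall fun s ↦ continuous_id.add ?_)
  exact continuous_finsetSum s fun i _ ↦
    ((𝒟.disc i).continuous_conj (g i).continuous).sub continuous_id

/-- `pasteFun` as a homeomorphism; the inverse pastes the inverse homeomorphisms. -/
noncomputable def paste : DiscHomeo where
  toFun := 𝒟.pasteFun g
  invFun := 𝒟.pasteFun fun i ↦ (g i).symm
  left_inv := 𝒟.pasteFun_symm_pasteFun g
  right_inv := 𝒟.pasteFun_symm_pasteFun fun i ↦ (g i).symm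
  continuous_toFun := 𝒟.continuous_pasteFun g
  continuous_invFun := 𝒟.continuous_pasteFun _
  apply_of_one_le _ hz := 𝒟.pasteFun_of_forall_notMem_ball g fun i ↦ 𝒟.notMem_ball_of_one_le i hz

theorem paste_of_mem {i : ι} {z : ℂ} (hz : z ∈ (𝒟.disc i).carrier) :
    𝒟.paste g z = (𝒟.disc i).conj (g i) z :=
  𝒟.pasteFun_of_mem g hz

theorem paste_of_forall_notMem {z : ℂ} (hz : ∀ i, z ∉ (𝒟.disc i).carrier) : 𝒟.paste g z = z :=
  𝒟.pasteFun_of_forall_notMem g hz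

theorem paste_chart (i : ι) {w : ℂ} (hw : ‖w‖ ≤ 1) :
    𝒟.paste g ((𝒟.disc i).chart w) = (𝒟.disc i).chart (g i w) := by
  rw [𝒟.paste_of_mem g ((𝒟.disc i).chart_mem_carrier.2 hw), Disc.conj_chart]

theorem exists_lipschitzWith_paste {L : ℝ≥0} (hg : ∀ i, LipschitzWith L (g i)) :
    ∃ L', LipschitzWith L' (𝒟.paste g) := by
  have hlip (i : ι) : LipschitzWith (L + 1) fun z ↦ (𝒟.disc i).conj (g i) z - z :=
    ((𝒟.disc i).lipschitzWith_conj (hg i)).sub LipschitzWith.id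
  have hnorm (z w : ℂ) (hzw : ¬∃ i, z ∈ (𝒟.disc i).carrier ∧ w ∈ (𝒟.disc i).carrier) :
      ‖𝒟.paste g z - z‖ ≤ (L + 1) * ‖z - w‖ := by
    by_cases hz : ∃ i, z ∈ (𝒟.disc i).carrier
    · obtain ⟨i, hi⟩ := hz
      have hwi : w ∉ (𝒟.disc i).carrier := fun hwi ↦ hzw ⟨i, hi, hwi⟩
      simpa [𝒟.paste_of_mem g hi, (𝒟.disc i).conj_of_notMem_carrier _ hwi]
        using (hlip i).norm_sub_le z w
    · push Not at hz
      rw [𝒟.paste_of_forall_notMem g hz, sub_self, norm_zero]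
      positivity
  refine ⟨1 + 2 * (L + 1), LipschitzWith.of_dist_le_mul fun z w ↦ ?_⟩
  rw [dist_eq_norm, dist_eq_norm]
  push_cast
  by_cases hzw : ∃ i, z ∈ (𝒟.disc i).carrier ∧ w ∈ (𝒟.disc i).carrier
  · obtain ⟨i, hz, hw⟩ := hzw
    rw [𝒟.paste_of_mem g hz, 𝒟.paste_of_mem g hw]
    refine (((𝒟.disc i).lipschitzWith_conj (hg i)).norm_sub_le z w).trans ?_
    gcongr
    linarith [L.2]
  · have hz := hnorm z w hzw
    have hw := hnorm w z fun ⟨i, hw, hz⟩ ↦ hzw ⟨i, hz, hw⟩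
    calc ‖𝒟.paste g z - 𝒟.paste g w‖
        = ‖(z - w) + (𝒟.paste g z - z) - (𝒟.paste g w - w)‖ := by congr 1; ring
      _ ≤ ‖z - w‖ + (L + 1) * ‖z - w‖ + (L + 1) * ‖w - z‖ :=
        (norm_sub_le _ _).trans (add_le_add ((norm_add_le _ _).trans (by gcongr)) hw)
      _ = _ := by rw [norm_sub_rev w z]; ring

theorem ae_notMem_or_mem_ball [Countable ι] :
    ∀ᵐ z, z ∉ insert 0 (⋃ i, (𝒟.disc i).carrier) ∨
      ∃ i, z ∈ ball (𝒟.disc i).center (𝒟.disc i).radius := by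
  have hsphere : ∀ᵐ z, ∀ i, z ∉ sphere (𝒟.disc i).center (𝒟.disc i).radius :=
    ae_all_iff.2 fun i ↦ measure_eq_zero_iff_ae_notMem.1 <|
      Measure.addHaar_sphere volume (𝒟.disc i).center (𝒟.disc i).radius
  filter_upwards [hsphere, compl_mem_ae_iff.2 (measure_singleton (0 : ℂ))] with z hz hz0
  by_cases hmem : ∃ i, z ∈ (𝒟.disc i).carrier
  · obtain ⟨i, hi⟩ := hmem
    exact Or.inr ⟨i, mem_ball.2 ((mem_closedBall.1 hi).lt_of_ne (hz i))⟩
  · left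
    rintro (rfl | hz')
    exacts [hz0 rfl, hmem (mem_iUnion.1 hz')]

theorem paste_eventuallyEq_id {z : ℂ} (hz : z ∉ insert 0 (⋃ i, (𝒟.disc i).carrier)) :
    𝒟.paste g =ᶠ[𝓝 z] id := by
  filter_upwards [𝒟.isClosed_insert_iUnion_carrier.isOpen_compl.mem_nhds hz] with w hw
  exact 𝒟.paste_of_forall_notMem g fun i hi ↦ hw (mem_insert_of_mem _ (mem_iUnion.2 ⟨i, hi⟩))

theorem paste_eventuallyEq_conj {i : ι} {z : ℂ}
    (hz : z ∈ ball (𝒟.disc i).center (𝒟.disc i).radius) :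
    𝒟.paste g =ᶠ[𝓝 z] (𝒟.disc i).conj (g i) := by
  filter_upwards [isOpen_ball.mem_nhds hz] with w hw
  exact 𝒟.paste_of_mem g (ball_subset_closedBall hw)

theorem ae_fderiv_paste [Countable ι] {g h : ι → DiscHomeo}
    {R : (ℂ →L[ℝ] ℂ) → (ℂ →L[ℝ] ℂ) → Prop}
    (hid : R (ContinuousLinearMap.id ℝ ℂ) (ContinuousLinearMap.id ℝ ℂ))
    (hR : ∀ i, ∀ᵐ w, R (fderiv ℝ (g i) w) (fderiv ℝ (h i) w)) :
    ∀ᵐ z, R (fderiv ℝ (𝒟.paste g) z) (fderiv ℝ (𝒟.paste h) z) := by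
  filter_upwards [𝒟.ae_notMem_or_mem_ball,
    ae_all_iff.2 fun i ↦ (𝒟.disc i).ae_chart_symm (hR i)] with z hz hRz
  rcases hz with hz | ⟨i, hz⟩
  · rwa [(𝒟.paste_eventuallyEq_id g hz).fderiv_eq, (𝒟.paste_eventuallyEq_id h hz).fderiv_eq,
      fderiv_id]
  · rw [(𝒟.paste_eventuallyEq_conj g hz).fderiv_eq, (𝒟.paste_eventuallyEq_conj h hz).fderiv_eq,
      Disc.fderiv_conj, Disc.fderiv_conj]
    exact hRz i

end Paste

end DiscFamily

theorem IsQCApprox.paste {ι : Type*} [Countable ι] (𝒟 : DiscFamily ι) {K : ℝ} (hK : 1 ≤ K)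
    {f : ℕ → DiscHomeo} {φ : DiscHomeo} (h : IsQCApprox K f φ) :
    IsQCApprox K (fun n ↦ 𝒟.paste fun _ ↦ f n) (𝒟.paste fun _ ↦ φ) where
  lipschitz n :=
    have ⟨_, hL⟩ := h.lipschitz n
    𝒟.exists_lipschitzWith_paste _ fun _ ↦ hL
  distortion n := 𝒟.ae_fderiv_paste (g := fun _ ↦ f n) (R := fun _ ↦ HasDistortion K)
    (hasDistortion_id hK) fun _ ↦ h.distortion n
  norm_mono n := 𝒟.ae_fderiv_paste (R := fun A B ↦ ‖A‖ ≤ ‖B‖) le_rfl fun _ ↦ h.norm_mono n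
  eventuallyEq := by
    filter_upwards [𝒟.ae_notMem_or_mem_ball,
      ae_all_iff.2 fun i ↦ (𝒟.disc i).ae_chart_symm h.eventuallyEq] with z hz heq
    rcases hz with hz | ⟨i, hz⟩
    · exact ⟨0, fun n _ ↦
        (𝒟.paste_eventuallyEq_id (fun _ ↦ f n) hz).trans
          (𝒟.paste_eventuallyEq_id (fun _ ↦ φ) hz).symm⟩
    · obtain ⟨N, hN⟩ := heq i
      exact ⟨N, fun n hn ↦ (𝒟.paste_eventuallyEq_conj (fun _ ↦ f n) hz).trans <|
        ((𝒟.disc i).conj_eventuallyEq (hN n hn)).trans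
          (𝒟.paste_eventuallyEq_conj (fun _ ↦ φ) hz).symm⟩

section UniformLimits

theorem exists_tendstoUniformly_of_dist_le {X Y : Type*} [PseudoMetricSpace X] [CompleteSpace X]
    {f : ℕ → Y → X} {C r : ℝ} (hr0 : 0 ≤ r) (hr1 : r < 1)
    (hf : ∀ n y, dist (f n y) (f (n + 1) y) ≤ C * r ^ n) :
    ∃ g : Y → X, TendstoUniformly f g atTop := by
  have hlim (y : Y) : ∃ x, Tendsto (fun n ↦ f n y) atTop (𝓝 x) :=
    cauchySeq_tendsto_of_complete (cauchySeq_of_le_geometric r C hr1 fun n ↦ hf n y)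
  choose g hg using hlim
  refine ⟨g, Metric.tendstoUniformly_iff.2 fun ε hε ↦ ?_⟩
  have htail : Tendsto (fun n ↦ C * r ^ n / (1 - r)) atTop (𝓝 0) := by
    simpa using ((tendsto_pow_atTop_nhds_zero_of_lt_one hr0 hr1).const_mul C).div_const (1 - r)
  filter_upwards [htail.eventually (gt_mem_nhds hε)] with n hn y
  rw [dist_comm]
  exact (dist_le_of_le_geometric_of_tendsto r C hr1 (fun n ↦ hf n y) (hg y) n).trans_lt hn

theorem DiscHomeo.exists_tendstoUniformly {f : ℕ → DiscHomeo} {C r : ℝ} (hr0 : 0 ≤ r) (hr1 : r < 1)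
    (hf : ∀ n z, dist (f n z) (f (n + 1) z) ≤ C * r ^ n)
    (hf_symm : ∀ n z, dist ((f n).symm z) ((f (n + 1)).symm z) ≤ C * r ^ n) :
    ∃ φ : DiscHomeo, TendstoUniformly (fun n ↦ f n) φ atTop := by
  obtain ⟨g, hg⟩ := exists_tendstoUniformly_of_dist_le hr0 hr1 hf
  obtain ⟨h, hh⟩ := exists_tendstoUniformly_of_dist_le hr0 hr1 hf_symm
  have hg_cont : Continuous g := hg.continuous (Frequently.of_forall fun n ↦ (f n).continuous)
  have hh_cont : Continuous h :=
    hh.continuous (Frequently.of_forall fun n ↦ (f n).symm.continuous)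
  refine ⟨⟨⟨⟨g, h, fun z ↦ ?_, fun z ↦ ?_⟩, hg_cont, hh_cont⟩, fun z hz ↦ ?_⟩, hg⟩
  · exact tendsto_nhds_unique ((hh.tendsto_comp hh_cont.continuousAt (hg.tendsto_at z)).congr
      fun n ↦ (f n).symm_apply_apply z) tendsto_const_nhds
  · exact tendsto_nhds_unique ((hg.tendsto_comp hg_cont.continuousAt (hh.tendsto_at z)).congr
      fun n ↦ (f n).apply_symm_apply z) tendsto_const_nhds
  · exact tendsto_nhds_unique ((hg.tendsto_at z).congr fun n ↦ (f n).apply_of_one_le z hz)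
      tendsto_const_nhds

theorem DiscHomeo.dist_apply_apply_le_two (g h : DiscHomeo) (z : ℂ) : dist (g z) (h z) ≤ 2 := by
  rcases le_total ‖z‖ 1 with hz | hz
  · have hdist := dist_le_norm_add_norm (g z) (h z)
    linarith [g.norm_apply_le_one hz, h.norm_apply_le_one hz]
  · rw [g.apply_of_one_le z hz, h.apply_of_one_le z hz, dist_self]
    exact zero_le_two

end UniformLimits

namespace Disc

theorem volume_carrier (D : Disc) :
    volume D.carrier = ENNReal.ofReal (D.radius ^ 2) * NNReal.pi := by
  rw [carrier, Complex.volume_closedBall, ENNReal.ofReal_pow D.radius_pos.le]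

open scoped Pointwise in
theorem volume_chart_image (D : Disc) (S : Set ℂ) :
    volume (D.chart '' S) = ENNReal.ofReal (D.radius ^ 2) * volume S := by
  have himage : D.chart '' S = D.center +ᵥ D.radius • S := by
    rw [← image_vadd, ← image_smul, image_image]
    rfl
  rw [himage, measure_vadd, Measure.addHaar_smul, Complex.finrank_real_complex,
    abs_of_nonneg (sq_nonneg _)]

theorem sum_radius_sq_le {ι : Type*} {s : Finset ι} {D : ι → Disc}
    (hdisj : (s : Set ι).PairwiseDisjoint fun i ↦ (D i).carrier) {c : ℂ} {ρ : ℝ} (hρ : 0 ≤ ρ)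
    (hsub : ∀ i ∈ s, (D i).carrier ⊆ closedBall c ρ) : ∑ i ∈ s, (D i).radius ^ 2 ≤ ρ ^ 2 := by
  have hvol : volume (⋃ i ∈ s, (D i).carrier) ≤ volume (closedBall c ρ) :=
    measure_mono (iUnion₂_subset hsub)
  rw [measure_biUnion_finset hdisj fun i _ ↦ (D i).isCompact_carrier.measurableSet,
    Complex.volume_closedBall] at hvol
  simp only [volume_carrier] at hvol
  rw [← Finset.sum_mul, ← ENNReal.ofReal_pow hρ, ← ENNReal.ofReal_sum_of_nonneg
    fun i _ ↦ sq_nonneg _] at hvol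
  exact (ENNReal.ofReal_le_ofReal_iff (sq_nonneg ρ)).1
    ((ENNReal.mul_le_mul_iff_left (by simp [NNReal.pi_ne_zero]) ENNReal.coe_ne_top).1 hvol)

/-- The concentric disc of `s` times the radius. -/
noncomputable def scale (D : Disc) (s : ℝ) (hs : 0 < s) : Disc :=
  ⟨D.center, s * D.radius, mul_pos hs D.radius_pos⟩

theorem scale_chart (D : Disc) {s : ℝ} (hs : 0 < s) (w : ℂ) :
    (D.scale s hs).chart w = D.chart (s • w) := by
  rw [chart_apply, chart_apply, smul_smul, mul_comm]
  rfl

theorem carrier_scale_subset (D : Disc) {s : ℝ} (hs : 0 < s) (hs1 : s ≤ 1) :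
    (D.scale s hs).carrier ⊆ D.carrier :=
  closedBall_subset_closedBall (mul_le_of_le_one_left D.radius_pos.le hs1)

end Disc

namespace DiscFamily

variable {ι : Type*} (𝒟 : DiscFamily ι)

theorem carrier_subset_closedBall (i : ι) : (𝒟.disc i).carrier ⊆ closedBall 0 1 :=
  closedBall_subset_closedBall' <| by
    rw [dist_zero_right, add_comm]
    exact 𝒟.norm_center_add_radius_le i

theorem radius_le_one (i : ι) : (𝒟.disc i).radius ≤ 1 :=
  (le_add_of_nonneg_left (norm_nonneg _)).trans (𝒟.norm_center_add_radius_le i)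

theorem sum_radius_sq_le_one [Fintype ι] : ∑ i, (𝒟.disc i).radius ^ 2 ≤ 1 := by
  simpa using Disc.sum_radius_sq_le (fun i _ j _ hij ↦ 𝒟.pairwise_disjoint hij) zero_le_one
    fun i (_ : i ∈ Finset.univ) ↦ 𝒟.carrier_subset_closedBall i

/-- The family of concentric discs whose radii are multiplied by the factors `s i`. -/
noncomputable def scale (s : ι → ℝ) (hs : ∀ i, 0 < s i) (hs1 : ∀ i, s i ≤ 1) : DiscFamily ι where
  disc i := (𝒟.disc i).scale (s i) (hs i)
  norm_center_add_radius_le i := (𝒟.norm_center_add_radius_le i).trans' <|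
    add_le_add_right (mul_le_of_le_one_left (𝒟.disc i).radius_pos.le (hs1 i)) _
  pairwise_disjoint i j hij := (𝒟.pairwise_disjoint hij).mono
    ((𝒟.disc i).carrier_scale_subset _ (hs1 i)) ((𝒟.disc j).carrier_scale_subset _ (hs1 j))
  tendsto_smallSets := tendsto_smallSets_iff.2 fun U hU ↦
    (tendsto_smallSets_iff.1 𝒟.tendsto_smallSets U hU).mono fun i hi ↦
      ((𝒟.disc i).carrier_scale_subset _ (hs1 i)).trans hi

end DiscFamily

/-- One generation of a Cantor construction: finitely many disjoint discs in the unit disc, together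
with the ratios of the concentric discs in which the next generation is inscribed. -/
structure NestedPacking where
  card : ℕ
  discs : DiscFamily (Fin card)
  ratio : Fin card → ℝ
  ratio_pos : ∀ i, 0 < ratio i
  ratio_le_half : ∀ i, ratio i ≤ 1 / 2

namespace NestedPacking

section Inner

variable (P : NestedPacking) (i : Fin P.card)

theorem ratio_le_one : P.ratio i ≤ 1 := (P.ratio_le_half i).trans one_half_lt_one.le

/-- The discs in which the next generation is inscribed. -/
noncomputable def inner : DiscFamily (Fin P.card) :=
  P.discs.scale P.ratio P.ratio_pos P.ratio_le_one

theorem inner_chart (w : ℂ) :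
    (P.inner.disc i).chart w = (P.discs.disc i).chart (P.ratio i • w) :=
  Disc.scale_chart _ (P.ratio_pos i) w

theorem inner_radius_le_half_mul : (P.inner.disc i).radius ≤ 1 / 2 * (P.discs.disc i).radius :=
  mul_le_mul_of_nonneg_right (P.ratio_le_half i) (P.discs.disc i).radius_pos.le

theorem inner_radius_le_half : (P.inner.disc i).radius ≤ 1 / 2 :=
  (P.inner_radius_le_half_mul i).trans <|
    mul_le_of_le_one_right one_half_pos.le (P.discs.radius_le_one i)

theorem sum_inner_radius_sq_le : ∑ i, (P.inner.disc i).radius ^ 2 ≤ 1 / 4 := by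
  calc ∑ i, (P.inner.disc i).radius ^ 2
      ≤ ∑ i, (1 / 2 * (P.discs.disc i).radius) ^ 2 := by
        gcongr with i
        exacts [(P.inner.disc i).radius_pos.le, P.inner_radius_le_half_mul i]
    _ = 1 / 4 * ∑ i, (P.discs.disc i).radius ^ 2 := by
        rw [Finset.mul_sum]
        exact Finset.sum_congr rfl fun i _ ↦ by ring
    _ ≤ 1 / 4 := mul_le_of_le_one_right (by norm_num) P.discs.sum_radius_sq_le_one

end Inner

section Stretch

variable {K : ℝ} (hK : 1 ≤ K) (P : NestedPacking) (i : Fin P.card)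

variable (K) in
theorem ratio_rpow_pos : 0 < P.ratio i ^ K := Real.rpow_pos_of_pos (P.ratio_pos i) K

include hK in
theorem ratio_rpow_le_ratio : P.ratio i ^ K ≤ P.ratio i :=
  Real.rpow_le_self_of_le_one (P.ratio_pos i).le (P.ratio_le_one i) hK

include hK in
theorem ratio_rpow_le_one : P.ratio i ^ K ≤ 1 :=
  (P.ratio_rpow_le_ratio hK i).trans (P.ratio_le_one i)

/-- The same discs with the `K`-th powers of the ratios. -/
noncomputable def rpow : NestedPacking where
  card := P.card
  discs := P.discs
  ratio i := P.ratio i ^ K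
  ratio_pos := P.ratio_rpow_pos K
  ratio_le_half i := (P.ratio_rpow_le_ratio hK i).trans (P.ratio_le_half i)

/-- The discs which the radial stretchings take to those of `P.inner`. -/
noncomputable def source : DiscFamily (Fin P.card) := (P.rpow hK).inner

/-- The `K`-quasiconformal map that stretches each disc radially, so that `P.source` is mapped onto
`P.inner`. -/
noncomputable def stretchMap : DiscHomeo :=
  P.discs.paste fun i ↦ radialStretchHomeo (P.ratio_rpow_pos K i) (P.ratio_rpow_le_one hK i)
    (inv_pos.2 (one_pos.trans_le hK))

theorem source_chart (w : ℂ) :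
    ((P.source hK).disc i).chart w = (P.discs.disc i).chart (P.ratio i ^ K • w) :=
  (P.rpow hK).inner_chart i w

theorem source_radius_le_inner_radius :
    ((P.source hK).disc i).radius ≤ (P.inner.disc i).radius :=
  mul_le_mul_of_nonneg_right (P.ratio_rpow_le_ratio hK i) (P.discs.disc i).radius_pos.le

theorem stretchMap_source_chart {w : ℂ} (hw : ‖w‖ ≤ 1) :
    P.stretchMap hK (((P.source hK).disc i).chart w) = (P.inner.disc i).chart w := by
  have hK0 : 0 < K := one_pos.trans_le hK
  have ha : 0 < P.ratio i ^ K := P.ratio_rpow_pos K i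
  have ha1 : P.ratio i ^ K ≤ 1 := P.ratio_rpow_le_one hK i
  have hnorm : ‖P.ratio i ^ K • w‖ ≤ P.ratio i ^ K := by
    rw [norm_smul, Real.norm_of_nonneg ha.le]
    exact mul_le_of_le_one_right ha.le hw
  have hratio : (P.ratio i ^ K) ^ (K⁻¹ - 1) * P.ratio i ^ K = P.ratio i := by
    rw [← Real.rpow_add_one ha.ne', sub_add_cancel, Real.rpow_rpow_inv (P.ratio_pos i).le hK0.ne']
  rw [source_chart, inner_chart, stretchMap, DiscFamily.paste_chart _ _ _ (hnorm.trans ha1)]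
  congr 1
  exact (radialStretch_of_norm_le ha1 hnorm).trans (by rw [smul_smul, hratio])

theorem exists_lipschitzWith_stretchMap : ∃ L, LipschitzWith L (P.stretchMap hK) := by
  choose L hL using fun i ↦ exists_lipschitzWith_radialStretch (q := K⁻¹) (P.ratio_rpow_pos K i)
    (P.ratio_rpow_le_one hK i)
  exact P.discs.exists_lipschitzWith_paste _ fun i ↦
    (hL i).weaken (Finset.le_sup (Finset.mem_univ i))

theorem ae_hasDistortion_fderiv_stretchMap :
    ∀ᵐ z, HasDistortion K (fderiv ℝ (P.stretchMap hK) z) ∧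
      1 ≤ ‖fderiv ℝ (P.stretchMap hK) z‖ :=
  P.discs.ae_fderiv_paste (h := fun _ ↦ DiscHomeo.refl)
    (R := fun A _ ↦ HasDistortion K A ∧ 1 ≤ ‖A‖) ⟨hasDistortion_id hK, by simp⟩ fun i ↦
      ae_hasDistortion_fderiv_radialStretch hK (P.ratio_rpow_pos K i) (P.ratio_rpow_le_one hK i)

end Stretch

end NestedPacking

theorem Disc.exists_chart_eq (D : Disc) {z : ℂ} (hz : z ∈ D.carrier) :
    ∃ w, ‖w‖ ≤ 1 ∧ D.chart w = z :=
  ⟨D.chart.symm z, D.norm_chart_symm_le_one.2 hz, D.chart.apply_symm_apply z⟩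

/-- The `n`-th approximation to the quasiconformal map of a Cantor construction: first the
approximation number `n - 1` belonging to the later generations acts inside the source discs of the
first generation, then the stretching takes these to the inner discs. -/
noncomputable def cantorMap {K : ℝ} (hK : 1 ≤ K) (P : ℕ → NestedPacking) : ℕ → DiscHomeo
  | 0 => DiscHomeo.refl
  | n + 1 => (((P 0).source hK).paste fun _ ↦ cantorMap hK (fun m ↦ P (m + 1)) n).trans
      ((P 0).stretchMap hK)

section CantorMap

variable {K : ℝ} (hK : 1 ≤ K) (P : ℕ → NestedPacking) (n : ℕ)

theorem cantorMap_zero : (cantorMap hK P 0 : ℂ → ℂ) = id := rfl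

theorem cantorMap_succ_source_chart (i : Fin (P 0).card) {w : ℂ} (hw : ‖w‖ ≤ 1) :
    cantorMap hK P (n + 1) ((((P 0).source hK).disc i).chart w)
      = ((P 0).inner.disc i).chart (cantorMap hK (fun m ↦ P (m + 1)) n w) := by
  refine (congrArg ((P 0).stretchMap hK) (((P 0).source hK).paste_chart _ i hw)).trans ?_
  exact (P 0).stretchMap_source_chart hK i (DiscHomeo.norm_apply_le_one _ hw)

theorem cantorMap_succ_of_forall_notMem {z : ℂ}
    (hz : ∀ i, z ∉ (((P 0).source hK).disc i).carrier) :
    cantorMap hK P (n + 1) z = (P 0).stretchMap hK z :=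
  congrArg ((P 0).stretchMap hK) (((P 0).source hK).paste_of_forall_notMem _ hz)

theorem cantorMap_succ_symm_inner_chart (i : Fin (P 0).card) {w : ℂ} (hw : ‖w‖ ≤ 1) :
    (cantorMap hK P (n + 1)).symm (((P 0).inner.disc i).chart w)
      = (((P 0).source hK).disc i).chart ((cantorMap hK (fun m ↦ P (m + 1)) n).symm w) := by
  set g := cantorMap hK (fun m ↦ P (m + 1)) n
  refine (cantorMap hK P (n + 1)).toHomeomorph.symm_apply_eq.2 ?_
  rw [cantorMap_succ_source_chart hK P n i (g.symm.norm_apply_le_one hw)]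
  exact congrArg _ (g.toHomeomorph.apply_symm_apply w).symm

theorem cantorMap_succ_symm_of_forall_notMem {z : ℂ}
    (hz : ∀ i, z ∉ ((P 0).inner.disc i).carrier) :
    (cantorMap hK P (n + 1)).symm z = ((P 0).stretchMap hK).symm z := by
  refine (cantorMap hK P (n + 1)).toHomeomorph.symm_apply_eq.2 ?_
  rw [cantorMap_succ_of_forall_notMem]
  · exact (((P 0).stretchMap hK).toHomeomorph.apply_symm_apply z).symm
  · intro i hi
    obtain ⟨w, hw, hwz⟩ := Disc.exists_chart_eq _ hi
    refine hz i ?_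
    have hinner := (P 0).stretchMap_source_chart hK i hw
    rw [hwz] at hinner
    rw [← ((P 0).stretchMap hK).toHomeomorph.apply_symm_apply z]
    exact hinner ▸ (Disc.chart_mem_carrier _).2 hw

theorem dist_cantorMap_succ_le (z : ℂ) :
    dist (cantorMap hK P n z) (cantorMap hK P (n + 1) z) ≤ 2 * (1 / 2) ^ n := by
  induction n generalizing P z with
  | zero => simpa using DiscHomeo.dist_apply_apply_le_two _ _ z
  | succ n ih =>
    by_cases hz : ∃ i, z ∈ (((P 0).source hK).disc i).carrier
    · obtain ⟨i, hi⟩ := hz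
      obtain ⟨w, hw, rfl⟩ := Disc.exists_chart_eq _ hi
      rw [cantorMap_succ_source_chart hK P _ i hw, cantorMap_succ_source_chart hK P _ i hw,
        Disc.dist_chart]
      refine (mul_le_mul ((P 0).inner_radius_le_half i) (ih _ w) dist_nonneg
        (by norm_num)).trans_eq ?_
      ring
    · push Not at hz
      rw [cantorMap_succ_of_forall_notMem hK P _ hz, cantorMap_succ_of_forall_notMem hK P _ hz,
        dist_self]
      positivity

theorem dist_cantorMap_succ_symm_le (z : ℂ) :
    dist ((cantorMap hK P n).symm z) ((cantorMap hK P (n + 1)).symm z) ≤ 2 * (1 / 2) ^ n := by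
  induction n generalizing P z with
  | zero => simpa using DiscHomeo.dist_apply_apply_le_two (DiscHomeo.symm _) (DiscHomeo.symm _) z
  | succ n ih =>
    by_cases hz : ∃ i, z ∈ ((P 0).inner.disc i).carrier
    · obtain ⟨i, hi⟩ := hz
      obtain ⟨w, hw, rfl⟩ := Disc.exists_chart_eq _ hi
      rw [cantorMap_succ_symm_inner_chart hK P _ i hw,
        cantorMap_succ_symm_inner_chart hK P _ i hw, Disc.dist_chart]
      refine (mul_le_mul (((P 0).rpow hK).inner_radius_le_half i) (ih _ w) dist_nonneg
        (by norm_num)).trans_eq ?_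
      ring
    · push Not at hz
      rw [cantorMap_succ_symm_of_forall_notMem hK P _ hz,
        cantorMap_succ_symm_of_forall_notMem hK P _ hz, dist_self]
      positivity

theorem cantorMap_succ_eventuallyEq_stretchMap {z : ℂ}
    (hz : z ∉ insert 0 (⋃ i, (((P 0).source hK).disc i).carrier)) :
    cantorMap hK P (n + 1) =ᶠ[𝓝 z] (P 0).stretchMap hK :=
  (((P 0).source hK).paste_eventuallyEq_id _ hz).mono fun _ hw ↦
    congrArg ((P 0).stretchMap hK) hw

theorem cantorMap_succ_eventuallyEq_chart {i : Fin (P 0).card} {z : ℂ}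
    (hz : z ∈ ball (((P 0).source hK).disc i).center (((P 0).source hK).disc i).radius) :
    cantorMap hK P (n + 1) =ᶠ[𝓝 z] fun w ↦ ((P 0).inner.disc i).chart
      (cantorMap hK (fun m ↦ P (m + 1)) n ((((P 0).source hK).disc i).chart.symm w)) := by
  filter_upwards [isOpen_ball.mem_nhds hz] with w hw
  rw [← cantorMap_succ_source_chart hK P n i
    ((Disc.norm_chart_symm_le_one _).2 (ball_subset_closedBall hw)), Homeomorph.apply_symm_apply]

theorem exists_lipschitzWith_cantorMap : ∃ L, LipschitzWith L (cantorMap hK P n) := by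
  induction n generalizing P with
  | zero => exact ⟨1, LipschitzWith.id⟩
  | succ n ih =>
    obtain ⟨L, hL⟩ := ih fun m ↦ P (m + 1)
    obtain ⟨L₁, hL₁⟩ := ((P 0).source hK).exists_lipschitzWith_paste _ fun _ ↦ hL
    obtain ⟨L₂, hL₂⟩ := (P 0).exists_lipschitzWith_stretchMap hK
    exact ⟨L₂ * L₁, hL₂.comp hL₁⟩

variable (m : ℕ)

theorem ae_fderiv_cantorMap_succ {R : (ℂ →L[ℝ] ℂ) → (ℂ →L[ℝ] ℂ) → Prop}
    (hstretch : ∀ᵐ z, R (fderiv ℝ ((P 0).stretchMap hK) z) (fderiv ℝ ((P 0).stretchMap hK) z))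
    (hmap : ∀ i, ∀ᵐ w,
      R ((((P 0).inner.disc i).radius / (((P 0).source hK).disc i).radius) •
          fderiv ℝ (cantorMap hK (fun k ↦ P (k + 1)) n) w)
        ((((P 0).inner.disc i).radius / (((P 0).source hK).disc i).radius) •
          fderiv ℝ (cantorMap hK (fun k ↦ P (k + 1)) m) w)) :
    ∀ᵐ z, R (fderiv ℝ (cantorMap hK P (n + 1)) z) (fderiv ℝ (cantorMap hK P (m + 1)) z) := by
  filter_upwards [((P 0).source hK).ae_notMem_or_mem_ball, hstretch,
    ae_all_iff.2 fun i ↦ (((P 0).source hK).disc i).ae_chart_symm (hmap i)] with z hz hs hm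
  rcases hz with hz | ⟨i, hz⟩
  · rwa [(cantorMap_succ_eventuallyEq_stretchMap hK P m hz).fderiv_eq,
      (cantorMap_succ_eventuallyEq_stretchMap hK P n hz).fderiv_eq]
  · rw [(cantorMap_succ_eventuallyEq_chart hK P m hz).fderiv_eq,
      (cantorMap_succ_eventuallyEq_chart hK P n hz).fderiv_eq,
      Disc.fderiv_chart_comp_chart_symm, Disc.fderiv_chart_comp_chart_symm]
    exact hm i

theorem ae_hasDistortion_fderiv_cantorMap :
    ∀ᵐ z, HasDistortion K (fderiv ℝ (cantorMap hK P n) z) := by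
  induction n generalizing P with
  | zero =>
    refine Eventually.of_forall fun z ↦ ?_
    rw [cantorMap_zero, fderiv_id]
    exact hasDistortion_id hK
  | succ n ih =>
    exact ae_fderiv_cantorMap_succ hK P n n (R := fun A _ ↦ HasDistortion K A)
      (((P 0).ae_hasDistortion_fderiv_stretchMap hK).mono fun _ hz ↦ hz.1)
      fun _ ↦ (ih _).mono fun _ hw ↦ hw.smul _

theorem ae_norm_fderiv_cantorMap_mono :
    ∀ᵐ z, ‖fderiv ℝ (cantorMap hK P n) z‖ ≤ ‖fderiv ℝ (cantorMap hK P (n + 1)) z‖ := by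
  induction n generalizing P with
  | zero =>
    have hone : ∀ᵐ z, 1 ≤ ‖fderiv ℝ (cantorMap hK P 1) z‖ := by
      refine ae_fderiv_cantorMap_succ hK P 0 0 (R := fun _ B ↦ 1 ≤ ‖B‖)
        (((P 0).ae_hasDistortion_fderiv_stretchMap hK).mono fun _ hz ↦ hz.2)
        fun i ↦ Eventually.of_forall fun w ↦ ?_
      simp only [cantorMap_zero, fderiv_id, norm_smul, ContinuousLinearMap.norm_id, mul_one]
      refine le_trans ?_ (le_abs_self _)
      rw [one_le_div (Disc.radius_pos _)]
      exact (P 0).source_radius_le_inner_radius hK i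
    filter_upwards [hone] with z hz
    rwa [cantorMap_zero, fderiv_id, ContinuousLinearMap.norm_id]
  | succ n ih =>
    refine ae_fderiv_cantorMap_succ hK P n (n + 1) (R := fun A B ↦ ‖A‖ ≤ ‖B‖)
      (Eventually.of_forall fun _ ↦ le_rfl) fun _ ↦ ?_
    filter_upwards [ih fun k ↦ P (k + 1)] with w hw
    simp only [norm_smul]
    gcongr

/-- The points near which the approximations do not all agree from the `n`-th on. -/
def unstableSet : Set ℂ := {z | ¬∀ᶠ w in 𝓝 z, ∀ m ≥ n, cantorMap hK P m w = cantorMap hK P n w}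

theorem ae_unstableSet_succ : ∀ᵐ z, z ∈ unstableSet hK P (n + 1) →
    ∃ i, z ∈ (((P 0).source hK).disc i).chart '' unstableSet hK (fun k ↦ P (k + 1)) n := by
  filter_upwards [((P 0).source hK).ae_notMem_or_mem_ball] with z hz hunstable
  contrapose! hunstable
  have hshift {w : ℂ} (hw : ∀ m ≥ n, cantorMap hK P (m + 1) w = cantorMap hK P (n + 1) w) :
      ∀ m ≥ n + 1, cantorMap hK P m w = cantorMap hK P (n + 1) w := by
    rintro (_ | m) hm
    · omega
    · exact hw m (by omega)
  refine not_not.2 ?_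
  rcases hz with hz | ⟨i, hz⟩
  · filter_upwards [((P 0).source hK).isClosed_insert_iUnion_carrier.isOpen_compl.mem_nhds hz]
      with w hw
    have hwi (i) : w ∉ (((P 0).source hK).disc i).carrier := fun hi ↦
      hw (mem_insert_of_mem _ (mem_iUnion.2 ⟨i, hi⟩))
    exact hshift fun m _ ↦ (cantorMap_succ_of_forall_notMem hK P m hwi).trans
      (cantorMap_succ_of_forall_notMem hK P n hwi).symm
  · have hstable : ∀ᶠ w in 𝓝 ((((P 0).source hK).disc i).chart.symm z), ∀ m ≥ n,
        cantorMap hK (fun k ↦ P (k + 1)) m w = cantorMap hK (fun k ↦ P (k + 1)) n w := by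
      by_contra h
      exact hunstable i ⟨_, h, Homeomorph.apply_symm_apply _ z⟩
    filter_upwards [isOpen_ball.mem_nhds hz,
      (((P 0).source hK).disc i).chart.symm.continuous.continuousAt.eventually hstable]
      with w hw hstable_w
    obtain ⟨u, hu, rfl⟩ := Disc.exists_chart_eq _ (ball_subset_closedBall hw)
    rw [Homeomorph.symm_apply_apply] at hstable_w
    refine hshift fun m hm ↦ ?_
    rw [cantorMap_succ_source_chart hK P m i hu, cantorMap_succ_source_chart hK P n i hu,
      hstable_w m hm]

theorem volume_unstableSet_le :
    volume (unstableSet hK P n) ≤ ENNReal.ofReal ((1 / 4) ^ n) * NNReal.pi := by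
  induction n generalizing P with
  | zero =>
    have hsub : unstableSet hK P 0 ⊆ closedBall 0 1 := by
      intro z hz
      by_contra hz1
      refine hz ?_
      filter_upwards [isClosed_closedBall.isOpen_compl.mem_nhds hz1] with w hw m _
      rw [mem_compl_iff, mem_closedBall_zero_iff, not_le] at hw
      rw [DiscHomeo.apply_of_one_le _ w hw.le, DiscHomeo.apply_of_one_le _ w hw.le]
    refine (measure_mono hsub).trans_eq ?_
    rw [Complex.volume_closedBall]
    simp
  | succ n ih =>
    calc volume (unstableSet hK P (n + 1))
        ≤ volume (⋃ i, (((P 0).source hK).disc i).chart ''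
            unstableSet hK (fun k ↦ P (k + 1)) n) :=
          measure_mono_ae ((ae_unstableSet_succ hK P n).mono fun _ hz h ↦ mem_iUnion.2 (hz h))
      _ ≤ ∑ i, ENNReal.ofReal ((((P 0).source hK).disc i).radius ^ 2) *
            volume (unstableSet hK (fun k ↦ P (k + 1)) n) := by
          refine (measure_iUnion_fintype_le _ _).trans_eq (Finset.sum_congr rfl fun i _ ↦ ?_)
          exact Disc.volume_chart_image _ _
      _ = ENNReal.ofReal (∑ i, (((P 0).source hK).disc i).radius ^ 2) *
            volume (unstableSet hK (fun k ↦ P (k + 1)) n) := by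
          rw [← Finset.sum_mul, ENNReal.ofReal_sum_of_nonneg fun i _ ↦ sq_nonneg _]
      _ ≤ ENNReal.ofReal (1 / 4) * (ENNReal.ofReal ((1 / 4) ^ n) * NNReal.pi) := by
          gcongr
          exacts [((P 0).rpow hK).sum_inner_radius_sq_le, ih _]
      _ = ENNReal.ofReal ((1 / 4) ^ (n + 1)) * NNReal.pi := by
          rw [← mul_assoc, ← ENNReal.ofReal_mul (by norm_num), pow_succ' (1 / 4 : ℝ)]

theorem ae_exists_notMem_unstableSet : ∀ᵐ z, ∃ n, z ∉ unstableSet hK P n := by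
  have hlim : Tendsto (fun n : ℕ ↦ ENNReal.ofReal ((1 / 4) ^ n) * NNReal.pi) atTop (𝓝 0) := by
    have hpow : Tendsto (fun n : ℕ ↦ ENNReal.ofReal ((1 / 4) ^ n)) atTop (𝓝 0) := by
      simpa using ENNReal.tendsto_ofReal (tendsto_pow_atTop_nhds_zero_of_lt_one
        (r := (1 / 4 : ℝ)) (by norm_num) (by norm_num))
    simpa using ENNReal.Tendsto.mul_const hpow (Or.inr ENNReal.coe_ne_top)
  refine ae_iff.2 (le_antisymm (ge_of_tendsto' hlim fun n ↦ ?_) zero_le)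
  refine (measure_mono fun z hz ↦ ?_).trans (volume_unstableSet_le hK P n)
  exact not_not.1 fun h ↦ hz ⟨n, h⟩

theorem exists_isQCApprox_cantorMap : ∃ φ : DiscHomeo, IsQCApprox K (cantorMap hK P) φ ∧
    TendstoUniformly (fun n ↦ cantorMap hK P n) φ atTop := by
  obtain ⟨φ, hφ⟩ := DiscHomeo.exists_tendstoUniformly one_half_pos.le one_half_lt_one
    (dist_cantorMap_succ_le hK P) (dist_cantorMap_succ_symm_le hK P)
  refine ⟨φ, ⟨exists_lipschitzWith_cantorMap hK P, ae_hasDistortion_fderiv_cantorMap hK P,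
    ae_norm_fderiv_cantorMap_mono hK P, ?_⟩, hφ⟩
  filter_upwards [ae_exists_notMem_unstableSet hK P] with z ⟨N, hN⟩
  have hlim : cantorMap hK P N =ᶠ[𝓝 z] φ := by
    filter_upwards [not_not.1 hN] with w hw
    exact tendsto_nhds_unique
      (tendsto_const_nhds.congr' ((eventually_ge_atTop N).mono fun m hm ↦ (hw m hm).symm))
      (hφ.tendsto_at w)
  refine ⟨N, fun n hn ↦ EventuallyEq.trans ?_ hlim⟩
  filter_upwards [not_not.1 hN] with w hw using hw n hn

end CantorMap

/-- The centre of the `n`-th generation disc with address `x` in the Cantor construction which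
inscribes the disc family `𝒟 (k + 1)` in each disc of `𝒟 k`. -/
noncomputable def codePoint {ι : ℕ → Type*} (𝒟 : ∀ n, DiscFamily (ι n)) (x : ∀ n, ι n) : ℕ → ℂ
  | 0 => 0
  | n + 1 => ((𝒟 0).disc (x 0)).chart (codePoint (fun k ↦ 𝒟 (k + 1)) (fun k ↦ x (k + 1)) n)

/-- The point of the Cantor set with address `x`. -/
noncomputable def codeLimit {ι : ℕ → Type*} (𝒟 : ∀ n, DiscFamily (ι n)) (x : ∀ n, ι n) : ℂ :=
  limUnder atTop (codePoint 𝒟 x)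

section Coding

variable {ι : ℕ → Type*} {𝒟 : ∀ n, DiscFamily (ι n)}

theorem DiscFamily.norm_chart_le_one {ι : Type*} (𝒟 : DiscFamily ι) (i : ι) {w : ℂ}
    (hw : ‖w‖ ≤ 1) : ‖(𝒟.disc i).chart w‖ ≤ 1 :=
  mem_closedBall_zero_iff.1
    (𝒟.carrier_subset_closedBall i ((𝒟.disc i).chart_mem_carrier.2 hw))

theorem norm_codePoint_le_one (x : ∀ n, ι n) (n : ℕ) : ‖codePoint 𝒟 x n‖ ≤ 1 := by
  induction n generalizing ι with
  | zero => simp [codePoint]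
  | succ n ih => exact (𝒟 0).norm_chart_le_one _ (ih _)

theorem continuous_codePoint [∀ n, TopologicalSpace (ι n)] [∀ n, DiscreteTopology (ι n)] (n : ℕ) :
    Continuous fun x ↦ codePoint 𝒟 x n := by
  induction n generalizing ι with
  | zero => exact continuous_const
  | succ n ih =>
    have hletter {α : Type} [TopologicalSpace α] (f : ι 0 → α) :
        Continuous fun x : ∀ n, ι n ↦ f (x 0) :=
      continuous_of_discreteTopology.comp (continuous_apply 0)
    have hshift : Continuous fun (x : ∀ n, ι n) k ↦ x (k + 1) :=
      continuous_pi fun k ↦ continuous_apply (k + 1)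
    exact (hletter fun i ↦ ((𝒟 0).disc i).center).add
      ((hletter fun i ↦ ((𝒟 0).disc i).radius).smul (ih.comp hshift))

variable (h𝒟 : ∀ n i, ((𝒟 n).disc i).radius ≤ 1 / 2)
include h𝒟

theorem dist_codePoint_succ_le (n : ℕ) (x : ∀ n, ι n) :
    dist (codePoint 𝒟 x n) (codePoint 𝒟 x (n + 1)) ≤ 1 * (1 / 2) ^ n := by
  induction n generalizing ι with
  | zero => simpa [codePoint] using (𝒟 0).norm_chart_le_one (x 0) (norm_zero.trans_le zero_le_one)
  | succ n ih =>
    rw [codePoint, codePoint, Disc.dist_chart]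
    refine (mul_le_mul (h𝒟 0 _) (ih (fun k ↦ h𝒟 (k + 1)) _) dist_nonneg
      one_half_pos.le).trans_eq ?_
    ring

theorem tendstoUniformly_codePoint :
    TendstoUniformly (fun n x ↦ codePoint 𝒟 x n) (codeLimit 𝒟) atTop := by
  obtain ⟨g, hg⟩ := exists_tendstoUniformly_of_dist_le one_half_pos.le one_half_lt_one
    (dist_codePoint_succ_le h𝒟)
  rwa [show codeLimit 𝒟 = g from funext fun x ↦ (hg.tendsto_at x).limUnder_eq]

theorem tendsto_codePoint (x : ∀ n, ι n) : Tendsto (codePoint 𝒟 x) atTop (𝓝 (codeLimit 𝒟 x)) :=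
  (tendstoUniformly_codePoint h𝒟).tendsto_at x

theorem codeLimit_eq_chart (x : ∀ n, ι n) : codeLimit 𝒟 x
    = ((𝒟 0).disc (x 0)).chart (codeLimit (fun k ↦ 𝒟 (k + 1)) fun k ↦ x (k + 1)) := by
  refine tendsto_nhds_unique ((tendsto_add_atTop_iff_nat 1).2 (tendsto_codePoint h𝒟 x)) ?_
  exact ((Homeomorph.continuous _).tendsto _).comp (tendsto_codePoint (fun k ↦ h𝒟 (k + 1)) _)

theorem dist_codeLimit_of_eq {x y : ∀ n, ι n} (hxy : x 0 = y 0) :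
    dist (codeLimit 𝒟 x) (codeLimit 𝒟 y) = ((𝒟 0).disc (x 0)).radius *
      dist (codeLimit (fun k ↦ 𝒟 (k + 1)) fun k ↦ x (k + 1))
        (codeLimit (fun k ↦ 𝒟 (k + 1)) fun k ↦ y (k + 1)) := by
  rw [codeLimit_eq_chart h𝒟 x, codeLimit_eq_chart h𝒟 y, ← hxy, Disc.dist_chart]

theorem norm_codeLimit_le_one (x : ∀ n, ι n) : ‖codeLimit 𝒟 x‖ ≤ 1 :=
  le_of_tendsto' (tendsto_codePoint h𝒟 x).norm (norm_codePoint_le_one x)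

theorem range_codeLimit_subset_closedBall : range (codeLimit 𝒟) ⊆ closedBall 0 1 :=
  range_subset_iff.2 fun x ↦ mem_closedBall_zero_iff.2 (norm_codeLimit_le_one h𝒟 x)

theorem codeLimit_mem_carrier (x : ∀ n, ι n) : codeLimit 𝒟 x ∈ ((𝒟 0).disc (x 0)).carrier := by
  rw [codeLimit_eq_chart h𝒟]
  exact (Disc.chart_mem_carrier _).2 (norm_codeLimit_le_one (fun k ↦ h𝒟 (k + 1)) _)

theorem continuous_codeLimit [∀ n, TopologicalSpace (ι n)] [∀ n, DiscreteTopology (ι n)] :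
    Continuous (codeLimit 𝒟) :=
  (tendstoUniformly_codePoint h𝒟).continuous (Frequently.of_forall continuous_codePoint)

theorem dist_codeLimit_le {x y : ∀ n, ι n} {n : ℕ} (hxy : ∀ j < n, x j = y j) :
    dist (codeLimit 𝒟 x) (codeLimit 𝒟 y)
      ≤ 2 * ∏ j ∈ Finset.range n, ((𝒟 j).disc (x j)).radius := by
  induction n generalizing ι with
  | zero =>
    have hdist := dist_le_norm_add_norm (codeLimit 𝒟 x) (codeLimit 𝒟 y)
    rw [Finset.prod_range_zero]
    linarith [norm_codeLimit_le_one h𝒟 x, norm_codeLimit_le_one h𝒟 y]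
  | succ n ih =>
    have htail := ih (fun k ↦ h𝒟 (k + 1)) (x := fun k ↦ x (k + 1)) (y := fun k ↦ y (k + 1))
      fun j hj ↦ hxy (j + 1) (Nat.succ_lt_succ hj)
    rw [dist_codeLimit_of_eq h𝒟 (hxy 0 n.succ_pos), Finset.prod_range_succ', ← mul_assoc, mul_comm]
    exact mul_le_mul_of_nonneg_right htail (Disc.radius_pos _).le

end Coding

section CodedMap

variable {K : ℝ} (hK : 1 ≤ K) (P : ℕ → NestedPacking)

theorem cantorMap_codePoint (n : ℕ) (x : ∀ k, Fin (P k).card) :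
    cantorMap hK P n (codePoint (fun k ↦ (P k).source hK) x n)
      = codePoint (fun k ↦ (P k).inner) x n := by
  induction n generalizing P with
  | zero => rfl
  | succ n ih =>
    rw [codePoint, codePoint, cantorMap_succ_source_chart hK P n _ (norm_codePoint_le_one _ n), ih]

theorem exists_isQCApprox_image_range_codeLimit : ∃ (f : ℕ → DiscHomeo) (φ : DiscHomeo),
    IsQCApprox K f φ ∧ φ '' range (codeLimit fun k ↦ (P k).source hK)
      = range (codeLimit fun k ↦ (P k).inner) := by
  obtain ⟨φ, hφ, hlim⟩ := exists_isQCApprox_cantorMap hK P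
  refine ⟨_, φ, hφ, ?_⟩
  rw [← range_comp]
  congr 1 with x
  have hsource := tendsto_codePoint (fun k ↦ ((P k).rpow hK).inner_radius_le_half) x
  have hmap := hlim.tendsto_comp φ.continuous.continuousAt hsource
  exact tendsto_nhds_unique (hmap.congr fun n ↦ cantorMap_codePoint hK P n x)
    (tendsto_codePoint (fun k ↦ (P k).inner_radius_le_half) x)

end CodedMap

section HausdorffUpperBound

variable {ι : ℕ → Type*} {𝒟 : ∀ n, DiscFamily (ι n)}
  (h𝒟 : ∀ n i, ((𝒟 n).disc i).radius ≤ 1 / 2)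

/-- The part of the Cantor set with addresses beginning with the word `w`. -/
def cylinder (𝒟 : ∀ n, DiscFamily (ι n)) (n : ℕ) (w : ∀ j : Fin n, ι j) : Set ℂ :=
  codeLimit 𝒟 '' {x | ∀ j : Fin n, x j = w j}

include h𝒟

theorem ediam_cylinder_le (n : ℕ) (w : ∀ j : Fin n, ι j) :
    ediam (cylinder 𝒟 n w) ≤ 2 * ∏ j : Fin n, ENNReal.ofReal ((𝒟 j).disc (w j)).radius := by
  refine ediam_le ?_
  rintro _ ⟨x, hx, rfl⟩ _ ⟨y, hy, rfl⟩
  have hdist := dist_codeLimit_le h𝒟 (x := x) (y := y) (n := n)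
    fun j hj ↦ (hx ⟨j, hj⟩).trans (hy ⟨j, hj⟩).symm
  rw [← Fin.prod_univ_eq_prod_range (fun j ↦ ((𝒟 j).disc (x j)).radius)] at hdist
  have hword (j : Fin n) : x j = w j := hx j
  simp only [hword] at hdist
  rw [edist_dist]
  refine (ENNReal.ofReal_le_ofReal hdist).trans_eq ?_
  rw [ENNReal.ofReal_mul zero_le_two, ENNReal.ofReal_ofNat,
    ENNReal.ofReal_prod_of_nonneg fun j _ ↦ (Disc.radius_pos _).le]

theorem ediam_cylinder_le_pow (n : ℕ) (w : ∀ j : Fin n, ι j) :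
    ediam (cylinder 𝒟 n w) ≤ 2 * ENNReal.ofReal (1 / 2) ^ n := by
  refine (ediam_cylinder_le h𝒟 n w).trans (mul_le_mul_right ?_ _)
  refine (Finset.prod_le_prod' fun (j : Fin n) _ ↦
    ENNReal.ofReal_le_ofReal (h𝒟 j (w j))).trans_eq ?_
  rw [Finset.prod_const, Finset.card_fin]

theorem sum_ediam_cylinder_rpow_le [∀ n, Fintype (ι n)] {d : ℝ} (hd : 0 ≤ d) (n : ℕ) :
    ∑ w, ediam (cylinder 𝒟 n w) ^ d
      ≤ 2 ^ d * ENNReal.ofReal (∏ j ∈ Finset.range n, ∑ i, ((𝒟 j).disc i).radius ^ d) := by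
  have hpos (j) (i : ι j) : 0 ≤ ((𝒟 j).disc i).radius ^ d :=
    Real.rpow_nonneg (Disc.radius_pos _).le d
  calc ∑ w, ediam (cylinder 𝒟 n w) ^ d
      ≤ ∑ w : ∀ j : Fin n, ι j, 2 ^ d * ∏ j : Fin n,
          ENNReal.ofReal (((𝒟 j).disc (w j)).radius ^ d) := by
        refine Finset.sum_le_sum fun w _ ↦ ?_
        refine (ENNReal.rpow_le_rpow (ediam_cylinder_le h𝒟 n w) hd).trans_eq ?_
        rw [ENNReal.mul_rpow_of_nonneg _ _ hd, ← ENNReal.prod_rpow_of_nonneg hd]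
        simp only [ENNReal.ofReal_rpow_of_pos (Disc.radius_pos _)]
    _ = 2 ^ d * ∏ j : Fin n, ∑ i, ENNReal.ofReal (((𝒟 j).disc i).radius ^ d) := by
        rw [← Finset.mul_sum, Fintype.prod_sum]
    _ = 2 ^ d * ENNReal.ofReal (∏ j ∈ Finset.range n, ∑ i, ((𝒟 j).disc i).radius ^ d) := by
        rw [← Fin.prod_univ_eq_prod_range (fun j ↦ ∑ i, ((𝒟 j).disc i).radius ^ d),
          ENNReal.ofReal_prod_of_nonneg fun (j : Fin n) _ ↦
            Finset.sum_nonneg fun i _ ↦ hpos j i]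
        congr 2 with j
        exact (ENNReal.ofReal_sum_of_nonneg fun i _ ↦ hpos j i).symm

theorem hausdorffMeasure_range_codeLimit_lt_top [∀ n, Fintype (ι n)] {d : ℝ} (hd : 0 ≤ d) {C : ℝ}
    (hC : ∀ n, ∏ j ∈ Finset.range n, ∑ i, ((𝒟 j).disc i).radius ^ d ≤ C) :
    μH[d] (range (codeLimit 𝒟)) < ⊤ := by
  have hsmall : Tendsto (fun n ↦ 2 * ENNReal.ofReal (1 / 2) ^ n) atTop (𝓝 0) := by
    have hlt : ENNReal.ofReal (1 / 2) < 1 := by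
      rw [← ENNReal.ofReal_one]
      exact (ENNReal.ofReal_lt_ofReal_iff one_pos).2 one_half_lt_one
    simpa using ENNReal.Tendsto.const_mul (ENNReal.tendsto_pow_atTop_nhds_zero_of_lt_one hlt)
      (Or.inr ENNReal.ofNat_ne_top)
  have hcover (n : ℕ) : range (codeLimit 𝒟) ⊆ ⋃ w, cylinder 𝒟 n w := by
    rintro _ ⟨x, rfl⟩
    exact mem_iUnion.2 ⟨fun j ↦ x j, x, fun _ ↦ rfl, rfl⟩
  calc μH[d] (range (codeLimit 𝒟)) ≤ liminf (fun n ↦ ∑ w, ediam (cylinder 𝒟 n w) ^ d) atTop :=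
        Measure.hausdorffMeasure_le_liminf_sum d _ _ hsmall (cylinder 𝒟)
          (Eventually.of_forall (ediam_cylinder_le_pow h𝒟)) (Eventually.of_forall hcover)
    _ ≤ 2 ^ d * ENNReal.ofReal C :=
        liminf_le_of_frequently_le' <| Frequently.of_forall fun n ↦
          (sum_ediam_cylinder_rpow_le h𝒟 hd n).trans
            (mul_le_mul_right (ENNReal.ofReal_le_ofReal (hC n)) _)
    _ < ⊤ := ENNReal.mul_lt_top (ENNReal.rpow_lt_top_of_nonneg hd ENNReal.ofNat_ne_top)
        ENNReal.ofReal_lt_top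

end HausdorffUpperBound

namespace NestedPacking

variable (Q : NestedPacking)

theorem radius_le_two_mul_dist {i j : Fin Q.card} (hij : i ≠ j) {z w : ℂ}
    (hz : z ∈ (Q.inner.disc i).carrier) (hw : w ∈ (Q.inner.disc j).carrier) :
    (Q.discs.disc i).radius ≤ 2 * dist z w := by
  have hdisj : (Q.discs.disc i).radius + (Q.discs.disc j).radius
      < dist (Q.discs.disc i).center (Q.discs.disc j).center :=
    (disjoint_closedBall_closedBall_iff (Disc.radius_pos _).le (Disc.radius_pos _).le).1
      (Q.discs.pairwise_disjoint hij)
  have htriangle :=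
    dist_triangle4 (Q.discs.disc i).center z w (Q.discs.disc j).center
  have hzi : dist (Q.discs.disc i).center z ≤ 1 / 2 * (Q.discs.disc i).radius :=
    (mem_closedBall'.1 hz).trans (Q.inner_radius_le_half_mul i)
  have hwj : dist w (Q.discs.disc j).center ≤ 1 / 2 * (Q.discs.disc j).radius :=
    (mem_closedBall.1 hw).trans (Q.inner_radius_le_half_mul j)
  linarith [(Q.discs.disc j).radius_pos]

theorem sum_radius_sq_le_of_nontrivial {T : Finset (Fin Q.card)} (hT : T.Nontrivial)
    {u : Fin Q.card → ℂ} (hu : ∀ i ∈ T, u i ∈ (Q.inner.disc i).carrier)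
    {δ : ℝ} (hδ : ∀ i ∈ T, ∀ j ∈ T, dist (u i) (u j) ≤ δ) :
    ∑ i ∈ T, (Q.discs.disc i).radius ^ 2 ≤ (4 * δ) ^ 2 := by
  have hradius : ∀ i ∈ T, (Q.discs.disc i).radius ≤ 2 * δ := by
    intro i hi
    obtain ⟨j, hj, hji⟩ := hT.exists_ne i
    linarith [Q.radius_le_two_mul_dist hji.symm (hu i hi) (hu j hj), hδ i hi j hj]
  obtain ⟨k, hk⟩ := hT.nonempty
  have hδ0 : 0 ≤ δ := dist_nonneg.trans (hδ k hk k hk)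
  refine Disc.sum_radius_sq_le (fun i _ j _ hij ↦ Q.discs.pairwise_disjoint hij) (c := u k)
    (by linarith) fun i hi ↦ closedBall_subset_closedBall' ?_
  have hcenter : dist (Q.discs.disc i).center (u i) ≤ 1 / 2 * (Q.discs.disc i).radius :=
    (mem_closedBall'.1 (hu i hi)).trans (Q.inner_radius_le_half_mul i)
  linarith [dist_triangle (Q.discs.disc i).center (u i) (u k), hδ i hi k hk, hradius i hi]

end NestedPacking

section Letters

/-- The `n`-th letters of the addresses in `A`. -/
noncomputable def letters {k : ℕ → ℕ} (A : Set (∀ n, Fin (k n))) (n : ℕ) :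
    Finset (Fin (k n)) :=
  (toFinite (Function.eval n '' A)).toFinset

theorem mem_letters {k : ℕ → ℕ} {A : Set (∀ n, Fin (k n))} {n : ℕ} {i : Fin (k n)} :
    i ∈ letters A n ↔ ∃ x ∈ A, x n = i :=
  Finite.mem_toFinset _

theorem letters_succ {k : ℕ → ℕ} (A : Set (∀ n, Fin (k n))) (n : ℕ) :
    letters A (n + 1) = letters (k := fun m ↦ k (m + 1)) ((fun x m ↦ x (m + 1)) '' A) n := by
  ext i
  simp only [mem_letters, exists_mem_image]

theorem dist_codeLimit_shift_le {P : ℕ → NestedPacking} {A : Set (∀ k, Fin (P k).card)}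
    {i : Fin (P 0).card} (hi : letters A 0 = {i}) {δ : ℝ} (hA : ∀ x ∈ A, ∀ y ∈ A,
      dist (codeLimit (fun k ↦ (P k).inner) x) (codeLimit (fun k ↦ (P k).inner) y) ≤ δ) :
    ∀ x ∈ (fun x k ↦ x (k + 1)) '' A, ∀ y ∈ (fun x k ↦ x (k + 1)) '' A,
      dist (codeLimit (fun k ↦ (P (k + 1)).inner) x) (codeLimit (fun k ↦ (P (k + 1)).inner) y)
        ≤ δ / ((P 0).inner.disc i).radius := by
  have hletter : ∀ x ∈ A, x 0 = i := fun x hx ↦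
    Finset.mem_singleton.1 (hi ▸ mem_letters.2 ⟨x, hx, rfl⟩)
  refine forall_mem_image.2 fun x hx ↦ forall_mem_image.2 fun y hy ↦
    (le_div_iff₀' (Disc.radius_pos _)).2 ?_
  have hxy := dist_codeLimit_of_eq (fun k ↦ (P k).inner_radius_le_half)
    ((hletter x hx).trans (hletter y hy).symm)
  rw [hletter x hx] at hxy
  exact hxy.symm.trans_le (hA x hx y hy)

end Letters

/-- Probability weights on the discs of a packing which are at most proportional to the areas of the
discs and at most the `d`-th powers of the inner radii. -/
structure IsFrostmanWeight (Q : NestedPacking) (d : ℝ) (p : Fin Q.card → ℝ) : Prop where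
  nonneg : ∀ i, 0 ≤ p i
  sum_eq_one : ∑ i, p i = 1
  le_radius_sq : ∀ i, p i ≤ 2 * (Q.discs.disc i).radius ^ 2
  le_inner_radius_rpow : ∀ i, p i ≤ (Q.inner.disc i).radius ^ d

namespace IsFrostmanWeight

section Weight

variable {Q : NestedPacking} {d : ℝ} {p : Fin Q.card → ℝ} (hp : IsFrostmanWeight Q d p)

include hp

theorem sum_le_one (T : Finset (Fin Q.card)) : ∑ i ∈ T, p i ≤ 1 :=
  (Finset.sum_le_univ_sum_of_nonneg hp.nonneg).trans_eq hp.sum_eq_one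

/-- The probability distribution with the given weights. -/
noncomputable def pmf : PMF (Fin Q.card) :=
  PMF.ofFintype (fun i ↦ ENNReal.ofReal (p i)) <| by
    rw [← ENNReal.ofReal_sum_of_nonneg fun i _ ↦ hp.nonneg i, hp.sum_eq_one, ENNReal.ofReal_one]

theorem pmf_toMeasure_apply (T : Finset (Fin Q.card)) :
    hp.pmf.toMeasure T = ENNReal.ofReal (∑ i ∈ T, p i) := by
  rw [PMF.toMeasure_apply_finset, ENNReal.ofReal_sum_of_nonneg fun i _ ↦ hp.nonneg i]
  rfl

theorem sum_le_of_nontrivial (hd : 0 ≤ d) (hd2 : d ≤ 2) {T : Finset (Fin Q.card)}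
    (hT : T.Nontrivial) {u : Fin Q.card → ℂ} (hu : ∀ i ∈ T, u i ∈ (Q.inner.disc i).carrier)
    {δ : ℝ} (hδ : ∀ i ∈ T, ∀ j ∈ T, dist (u i) (u j) ≤ δ) : ∑ i ∈ T, p i ≤ 32 * δ ^ d := by
  obtain ⟨i, hi, j, hj, hij⟩ := hT
  have hδ0 : 0 < δ := by
    have hradius := Q.radius_le_two_mul_dist hij (hu i hi) (hu j hj)
    linarith [hδ i hi j hj, (Q.discs.disc i).radius_pos]
  rcases le_total 1 δ with hδ1 | hδ1
  · linarith [hp.sum_le_one T, Real.one_le_rpow hδ1 hd]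
  · calc ∑ i ∈ T, p i ≤ ∑ i ∈ T, 2 * (Q.discs.disc i).radius ^ 2 :=
          Finset.sum_le_sum fun i _ ↦ hp.le_radius_sq i
      _ ≤ 32 * δ ^ 2 := by
          rw [← Finset.mul_sum]
          linarith [Q.sum_radius_sq_le_of_nontrivial ⟨i, hi, j, hj, hij⟩ hu hδ]
      _ ≤ 32 * δ ^ d := by
          gcongr
          rw [← Real.rpow_two]
          exact Real.rpow_le_rpow_of_exponent_ge hδ0 hδ1 hd2

end Weight

section Frostman

variable {P : ℕ → NestedPacking} {d : ℝ} {p : ∀ n, Fin (P n).card → ℝ}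

variable (hp : ∀ n, IsFrostmanWeight (P n) d (p n))
include hp

theorem sum_letters_zero_le (hd : 0 ≤ d) (hd2 : d ≤ 2) {A : Set (∀ k, Fin (P k).card)}
    (hA0 : (letters A 0).Nontrivial) {δ : ℝ} (hA : ∀ x ∈ A, ∀ y ∈ A,
      dist (codeLimit (fun k ↦ (P k).inner) x) (codeLimit (fun k ↦ (P k).inner) y) ≤ δ) :
    ∑ i ∈ letters A 0, p 0 i ≤ 32 * δ ^ d := by
  have : Nonempty (∀ k, Fin (P k).card) :=
    ⟨(mem_letters.1 hA0.nonempty.choose_spec).choose⟩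
  choose! x hxA hx using fun i (hi : i ∈ letters A 0) ↦ mem_letters.1 hi
  refine (hp 0).sum_le_of_nontrivial hd hd2 hA0
    (u := fun i ↦ codeLimit (fun k ↦ (P k).inner) (x i)) (fun i hi ↦ ?_)
    fun i hi j hj ↦ hA _ (hxA i hi) _ (hxA j hj)
  simpa only [hx i hi] using
    codeLimit_mem_carrier (fun k ↦ (P k).inner_radius_le_half) (x i)

theorem prod_sum_letters_le (hd : 0 ≤ d) (hd2 : d ≤ 2) (n : ℕ) {A : Set (∀ k, Fin (P k).card)}
    {δ : ℝ} (hδ : 0 ≤ δ) (hA : ∀ x ∈ A, ∀ y ∈ A,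
      dist (codeLimit (fun k ↦ (P k).inner) x) (codeLimit (fun k ↦ (P k).inner) y) ≤ δ) :
    ∏ j ∈ Finset.range n, ∑ i ∈ letters A j, p j i ≤ 32 * δ ^ d + ((1 / 2) ^ n) ^ d := by
  induction n generalizing P δ with
  | zero => simpa using Real.rpow_nonneg hδ d
  | succ n ih =>
    have hnonneg (j : ℕ) : 0 ≤ ∑ i ∈ letters A j, p j i :=
      Finset.sum_nonneg fun i _ ↦ (hp j).nonneg i
    rw [Finset.prod_range_succ']
    rcases (letters A 0).eq_empty_or_nonempty with hempty | hne
    · rw [hempty, Finset.sum_empty, mul_zero]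
      positivity
    rcases hne.exists_eq_singleton_or_nontrivial with ⟨i, hi⟩ | hnontrivial
    · set q := ((P 0).inner.disc i).radius
      have hq : 0 < q := Disc.radius_pos _
      have htail : ∏ j ∈ Finset.range n, ∑ i ∈ letters A (j + 1), p (j + 1) i
          ≤ 32 * (δ / q) ^ d + ((1 / 2) ^ n) ^ d := by
        simp only [letters_succ]
        exact ih (fun k ↦ hp (k + 1)) (by positivity) (dist_codeLimit_shift_le hi hA)
      rw [hi, Finset.sum_singleton]
      calc (∏ j ∈ Finset.range n, ∑ i ∈ letters A (j + 1), p (j + 1) i) * p 0 i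
          ≤ (32 * (δ / q) ^ d + ((1 / 2) ^ n) ^ d) * q ^ d :=
            mul_le_mul htail ((hp 0).le_inner_radius_rpow i) ((hp 0).nonneg i) (by positivity)
        _ = 32 * δ ^ d + ((1 / 2) ^ n) ^ d * q ^ d := by
            rw [Real.div_rpow hδ hq.le]
            field_simp
        _ ≤ 32 * δ ^ d + ((1 / 2) ^ n) ^ d * (1 / 2) ^ d := by
            gcongr
            exact (P 0).inner_radius_le_half i
        _ = 32 * δ ^ d + ((1 / 2) ^ (n + 1)) ^ d := by
            rw [← Real.mul_rpow (by positivity) (by positivity), ← pow_succ]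
    · have htail : ∏ j ∈ Finset.range n, ∑ i ∈ letters A (j + 1), p (j + 1) i ≤ 1 :=
        Finset.prod_le_one (fun j _ ↦ hnonneg (j + 1)) fun j _ ↦ (hp (j + 1)).sum_le_one _
      have hrest : 0 ≤ ((1 / 2 : ℝ) ^ (n + 1)) ^ d := by positivity
      linarith [mul_le_of_le_one_left (hnonneg 0) htail,
        sum_letters_zero_le hp hd hd2 hnontrivial hA]

theorem infinitePi_preimage_le (hd : 0 < d) (hd2 : d ≤ 2) (U : Set ℂ) :
    Measure.infinitePi (fun n ↦ (hp n).pmf.toMeasure) (codeLimit (fun k ↦ (P k).inner) ⁻¹' U)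
      ≤ 32 * ediam U ^ d := by
  by_cases hU : ediam U = ⊤
  · rw [hU, ENNReal.top_rpow_of_pos hd, ENNReal.mul_top (by norm_num)]
    exact le_top
  set A := codeLimit (fun k ↦ (P k).inner) ⁻¹' U
  set δ := (ediam U).toReal
  have hδU : ediam U = ENNReal.ofReal δ := (ENNReal.ofReal_toReal hU).symm
  have hδ : 0 ≤ δ := ENNReal.toReal_nonneg
  have hA : ∀ x ∈ A, ∀ y ∈ A,
      dist (codeLimit (fun k ↦ (P k).inner) x) (codeLimit (fun k ↦ (P k).inner) y) ≤ δ := by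
    intro x hx y hy
    rw [dist_edist]
    exact ENNReal.toReal_mono hU (edist_le_ediam_of_mem hx hy)
  have hcylinder (n : ℕ) : Measure.infinitePi (fun n ↦ (hp n).pmf.toMeasure) A
      ≤ ENNReal.ofReal (32 * δ ^ d + ((1 / 2) ^ n) ^ d) := by
    have hsub : A ⊆ (Finset.range n : Set ℕ).pi fun j ↦ (letters A j : Set (Fin (P j).card)) :=
      fun x hx j _ ↦ mem_letters.2 ⟨x, hx, rfl⟩
    refine (measure_mono hsub).trans ?_
    rw [Measure.infinitePi_pi _ fun j _ ↦ (letters A j).measurableSet]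
    simp only [pmf_toMeasure_apply]
    rw [← ENNReal.ofReal_prod_of_nonneg fun j _ ↦ Finset.sum_nonneg fun i _ ↦ (hp j).nonneg i]
    exact ENNReal.ofReal_le_ofReal (prod_sum_letters_le hp hd.le hd2 n hδ hA)
  have hlim : Tendsto (fun n : ℕ ↦ ENNReal.ofReal (32 * δ ^ d + ((1 / 2) ^ n) ^ d)) atTop
      (𝓝 (ENNReal.ofReal (32 * δ ^ d))) := by
    have hpow := (tendsto_pow_atTop_nhds_zero_of_lt_one (one_half_pos (α := ℝ)).le
      one_half_lt_one).rpow_const (p := d) (Or.inr hd.le)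
    rw [Real.zero_rpow hd.ne'] at hpow
    simpa using ENNReal.tendsto_ofReal (hpow.const_add (32 * δ ^ d))
  refine (ge_of_tendsto' hlim hcylinder).trans_eq ?_
  rw [ENNReal.ofReal_mul (by norm_num), ENNReal.ofReal_ofNat, hδU,
    ENNReal.ofReal_rpow_of_nonneg hδ hd.le]

theorem hausdorffMeasure_range_codeLimit_pos (hd : 0 < d) (hd2 : d ≤ 2) :
    0 < μH[d] (range (codeLimit fun k ↦ (P k).inner)) := by
  set μ := Measure.infinitePi fun n ↦ (hp n).pmf.toMeasure
  have hcont : Continuous (codeLimit fun k ↦ (P k).inner) :=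
    continuous_codeLimit fun k ↦ (P k).inner_radius_le_half
  have hle : (32⁻¹ : ℝ≥0∞) • μ.map (codeLimit fun k ↦ (P k).inner) ≤ μH[d] := by
    refine Measure.le_hausdorffMeasure d _ 1 one_pos fun s _ ↦ ?_
    rw [Measure.smul_apply, smul_eq_mul]
    calc 32⁻¹ * μ.map (codeLimit fun k ↦ (P k).inner) s
        ≤ 32⁻¹ * μ.map (codeLimit fun k ↦ (P k).inner) (closure s) := by
          gcongr
          exact subset_closure
      _ ≤ 32⁻¹ * (32 * ediam (closure s) ^ d) := by
          rw [Measure.map_apply hcont.measurable isClosed_closure.measurableSet]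
          gcongr
          exact infinitePi_preimage_le hp hd hd2 _
      _ = ediam s ^ d := by
          rw [ediam_closure, ENNReal.inv_mul_cancel_left (by norm_num) (by norm_num)]
  refine lt_of_lt_of_le ?_ (hle (range (codeLimit fun k ↦ (P k).inner)))
  rw [Measure.smul_apply, smul_eq_mul, Measure.map_apply hcont.measurable
    (isCompact_range hcont).measurableSet, preimage_range, measure_univ, mul_one]
  exact ENNReal.inv_pos.2 (by norm_num)

end Frostman

end IsFrostmanWeight

section Copies

theorem sigmaFinite_restrict_iUnion {α ι : Type*} [MeasurableSpace α] [Countable ι] {μ : Measure α}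
    {S : ι → Set α} (hS : ∀ i, MeasurableSet (S i)) (hμ : ∀ i, μ (S i) < ⊤) :
    SigmaFinite (μ.restrict (⋃ i, S i)) := by
  refine Measure.sigmaFinite_of_countable (S := insert (⋃ i, S i)ᶜ (range S))
    ((countable_range S).insert _) ?_ ?_
  · rintro _ (rfl | ⟨i, rfl⟩)
    · rw [Measure.restrict_apply (MeasurableSet.iUnion hS).compl, compl_inter_self, measure_empty]
      exact ENNReal.zero_lt_top
    · exact (Measure.restrict_apply_le _ _).trans_lt (hμ i)
  · rw [sUnion_insert, sUnion_range, compl_union_self]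

open scoped Pointwise in
theorem Disc.hausdorffMeasure_chart_image (D : Disc) {d : ℝ} (hd : 0 ≤ d) (E : Set ℂ) :
    μH[d] (D.chart '' E) = ENNReal.ofReal (D.radius ^ d) * μH[d] E := by
  have himage : D.chart '' E = IsometryEquiv.addLeft D.center '' (D.radius • E) := by
    rw [← image_smul, image_image]
    rfl
  rw [himage, IsometryEquiv.hausdorffMeasure_image,
    Measure.hausdorffMeasure_smul₀ hd D.radius_pos.ne', ENNReal.smul_def, smul_eq_mul,
    ENNReal.coe_rpow_of_nonneg _ hd, ← ENNReal.ofReal_rpow_of_pos D.radius_pos,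
    Real.nnnorm_of_nonneg D.radius_pos.le, ENNReal.ofReal_eq_coe_nnreal]

namespace DiscFamily

variable {ι : Type*} (𝒟 : DiscFamily ι)

/-- The union of the similar copies of `E` in the discs of the family, together with the origin, to
which the discs shrink. -/
def copies (E : Set ℂ) : Set ℂ := insert 0 (⋃ i, (𝒟.disc i).chart '' E)

variable {E : Set ℂ}

theorem chart_image_subset_carrier (hE1 : E ⊆ closedBall 0 1) (i : ι) :
    (𝒟.disc i).chart '' E ⊆ (𝒟.disc i).carrier :=
  image_subset_iff.2 fun _ hw ↦ (𝒟.disc i).chart_mem_carrier.2 (mem_closedBall_zero_iff.1 (hE1 hw))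

theorem isCompact_copies (hE : IsCompact E) (hE1 : E ⊆ closedBall 0 1) :
    IsCompact (𝒟.copies E) :=
  isCompact_insert_iUnion (fun i ↦ hE.image (𝒟.disc i).chart.continuous) <|
    tendsto_smallSets_iff.2 fun U hU ↦ (tendsto_smallSets_iff.1 𝒟.tendsto_smallSets U hU).mono
      fun i hi ↦ (𝒟.chart_image_subset_carrier hE1 i).trans hi

theorem paste_image_copies (h0 : ∀ i, 0 ∉ (𝒟.disc i).carrier) (φ : DiscHomeo)
    (hE1 : E ⊆ closedBall 0 1) : 𝒟.paste (fun _ ↦ φ) '' 𝒟.copies E = 𝒟.copies (φ '' E) := by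
  rw [copies, copies, image_insert_eq, 𝒟.paste_of_forall_notMem _ h0, image_iUnion]
  congr! 3 with i
  rw [image_image, image_image]
  exact image_congr fun w hw ↦ 𝒟.paste_chart _ i (mem_closedBall_zero_iff.1 (hE1 hw))

theorem copies_ae_eq {d : ℝ} (hd : 0 < d) :
    𝒟.copies E =ᵐ[μH[d]] ⋃ i, (𝒟.disc i).chart '' E :=
  have := Measure.nullSingletonClass_hausdorff ℂ hd
  insert_ae_eq_self 0 _

variable [Countable ι]

theorem hausdorffMeasure_copies {d : ℝ} (hd : 0 < d) (hE : IsCompact E)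
    (hE1 : E ⊆ closedBall 0 1) :
    μH[d] (𝒟.copies E) = (∑' i, ENNReal.ofReal ((𝒟.disc i).radius ^ d)) * μH[d] E := by
  have hdisj : Pairwise fun i j ↦ Disjoint ((𝒟.disc i).chart '' E) ((𝒟.disc j).chart '' E) :=
    fun i j hij ↦ (𝒟.pairwise_disjoint hij).mono (𝒟.chart_image_subset_carrier hE1 i)
      (𝒟.chart_image_subset_carrier hE1 j)
  rw [measure_congr (𝒟.copies_ae_eq hd), measure_iUnion hdisj fun i ↦
    (hE.image (𝒟.disc i).chart.continuous).measurableSet, ← ENNReal.tsum_mul_right]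
  exact tsum_congr fun i ↦ (𝒟.disc i).hausdorffMeasure_chart_image hd.le E

theorem sigmaFinite_restrict_copies {d : ℝ} (hd : 0 < d) (hE : IsCompact E) (hE_top : μH[d] E < ⊤) :
    SigmaFinite ((μH[d] : Measure ℂ).restrict (𝒟.copies E)) := by
  rw [Measure.restrict_congr_set (𝒟.copies_ae_eq hd)]
  refine sigmaFinite_restrict_iUnion
    (fun i ↦ (hE.image (𝒟.disc i).chart.continuous).measurableSet) fun i ↦ ?_
  rw [(𝒟.disc i).hausdorffMeasure_chart_image hd.le]
  exact ENNReal.mul_lt_top ENNReal.ofReal_lt_top hE_top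

end DiscFamily

end Copies

section DiscPackings

theorem exists_disjoint_discs_one_le_tsum_radius_sq {δ : ℝ} (hδ : 0 < δ) :
    ∃ (ι : Type) (_ : Countable ι) (D : ι → Disc), (∀ i, (D i).radius ≤ δ) ∧
      (∀ i, ‖(D i).center‖ + (D i).radius ≤ 1) ∧
      (Pairwise fun i j ↦ Disjoint (D i).carrier (D j).carrier) ∧
      1 ≤ ∑' i, ENNReal.ofReal ((D i).radius ^ 2) := by
  obtain ⟨t, r, ht, -, hr, hcover, hdisj⟩ := Besicovitch.exists_disjoint_closedBall_covering_ae
    (volume : Measure ℂ) (fun _ ↦ univ) (ball 0 1) (fun x _ ε hε ↦ by simpa using hε)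
    (fun x ↦ min δ (1 - ‖x‖)) fun x hx ↦ lt_min hδ (sub_pos.2 (mem_ball_zero_iff.1 hx))
  have hcount : Countable t := ht
  let D (x : t) : Disc := ⟨x, r x, (hr x x.2).2.1⟩
  have hvolume : volume (ball (0 : ℂ) 1) ≤ ∑' x, volume (D x).carrier := by
    rw [biUnion_eq_iUnion] at hcover
    exact (measure_mono_ae (ae_le_set.2 hcover)).trans (measure_iUnion_le _)
  refine ⟨t, hcount, D, fun x ↦ ?_, fun x ↦ ?_, fun x y hxy ↦ ?_, ?_⟩
  · exact (hr x x.2).2.2.le.trans (min_le_left _ _)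
  · exact (le_sub_iff_add_le'.1 ((hr x x.2).2.2.le.trans (min_le_right _ _)))
  · exact hdisj x.2 y.2 (Subtype.coe_ne_coe.2 hxy)
  · simp only [Disc.volume_carrier, ENNReal.tsum_mul_right] at hvolume
    rw [Complex.volume_ball, ENNReal.ofReal_one, one_pow] at hvolume
    exact (ENNReal.mul_le_mul_iff_left (by simp [NNReal.pi_ne_zero]) ENNReal.coe_ne_top).1 hvolume

theorem exists_discFamily_le_sum_radius_sq {δ η : ℝ} (hδ : 0 < δ) (hη : η < 1) :
    ∃ (n : ℕ) (𝒟 : DiscFamily (Fin n)), (∀ i, (𝒟.disc i).radius ≤ δ) ∧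
      η ≤ ∑ i, (𝒟.disc i).radius ^ 2 := by
  obtain ⟨ι, -, D, hradius, hD, hdisj, hsum⟩ := exists_disjoint_discs_one_le_tsum_radius_sq hδ
  obtain ⟨s, hs⟩ : ∃ s : Finset ι, ENNReal.ofReal η < ∑ i ∈ s, ENNReal.ofReal ((D i).radius ^ 2) :=
    lt_iSup_iff.1 <| ENNReal.tsum_eq_iSup_sum (α := ι) ▸ hsum.trans_lt' (ENNReal.ofReal_lt_one.2 hη)
  rw [← ENNReal.ofReal_sum_of_nonneg fun i _ ↦ sq_nonneg _] at hs
  let e := s.equivFin.symm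
  refine ⟨s.card, ⟨fun i ↦ D (e i), fun i ↦ hD _, fun i j hij ↦ hdisj ?_, by simp⟩,
    fun i ↦ hradius _, ?_⟩
  · exact Subtype.coe_ne_coe.2 (e.injective.ne hij)
  · rw [e.sum_comp fun i : s ↦ (D i).radius ^ 2, Finset.sum_coe_sort s fun i ↦ (D i).radius ^ 2]
    exact (ENNReal.ofReal_lt_ofReal_iff'.1 hs).1.le

theorem exists_forall_le_two_mul_sq_le_rpow {c t : ℝ} (hc : 0 < c) (ht : t < 2) :
    ∃ δ > 0, ∀ r, 0 < r → r ≤ δ → 2 * r ^ 2 ≤ (c * r) ^ t := by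
  have hlim : Tendsto (fun r : ℝ ↦ r ^ (2 - t)) (𝓝 0) (𝓝 0) := by
    have hcont := (Real.continuousAt_rpow_const 0 (2 - t) (Or.inr (sub_pos.2 ht).le)).tendsto
    rwa [Real.zero_rpow (sub_pos.2 ht).ne'] at hcont
  obtain ⟨δ, hδ, hsmall⟩ := Metric.nhds_basis_closedBall.eventually_iff.1
    (hlim.eventually_le_const (show 0 < c ^ t / 2 by positivity))
  refine ⟨δ, hδ, fun r hr hrδ ↦ ?_⟩
  calc 2 * r ^ 2 = 2 * r ^ (2 - t) * r ^ t := by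
        rw [mul_assoc, ← Real.rpow_add hr, sub_add_cancel, Real.rpow_two]
    _ ≤ 2 * (c ^ t / 2) * r ^ t := by
        gcongr
        exact hsmall (by rwa [mem_closedBall_zero_iff, Real.norm_of_nonneg hr.le])
    _ = (c * r) ^ t := by rw [mul_div_cancel₀ _ two_ne_zero, Real.mul_rpow hc.le hr.le]

theorem exists_discFamily_one_le_sum_rpow {c t : ℝ} (hc : 0 < c) (ht : t < 2) :
    ∃ (n : ℕ) (𝒟 : DiscFamily (Fin n)), 1 ≤ ∑ i, (c * (𝒟.disc i).radius) ^ t := by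
  obtain ⟨δ, hδ, hδt⟩ := exists_forall_le_two_mul_sq_le_rpow hc ht
  obtain ⟨n, 𝒟, hradius, hsum⟩ := exists_discFamily_le_sum_radius_sq hδ one_half_lt_one
  refine ⟨n, 𝒟, ?_⟩
  calc (1 : ℝ) ≤ ∑ i, 2 * (𝒟.disc i).radius ^ 2 := by
        rw [← Finset.mul_sum]
        linarith
    _ ≤ _ := Finset.sum_le_sum fun i _ ↦ hδt _ (𝒟.disc i).radius_pos (hradius i)

/-- The disc which occupies the same position in `D` as `D'` in the unit disc. -/
noncomputable def Disc.comp (D D' : Disc) : Disc :=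
  ⟨D.chart D'.center, D.radius * D'.radius, mul_pos D.radius_pos D'.radius_pos⟩

theorem Disc.carrier_comp (D D' : Disc) : (D.comp D').carrier = D.chart '' D'.carrier := by
  ext z
  obtain ⟨w, rfl⟩ := D.chart.surjective z
  rw [D.chart.injective.mem_set_image, carrier, carrier, mem_closedBall, mem_closedBall]
  exact (D.dist_chart w _).symm ▸ mul_le_mul_iff_right₀ D.radius_pos

namespace DiscFamily

theorem carrier_comp_subset {ι : Type*} (𝒟 : DiscFamily ι) (D : Disc) (i : ι) :
    (D.comp (𝒟.disc i)).carrier ⊆ D.carrier := by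
  rw [Disc.carrier_comp, image_subset_iff]
  exact fun w hw ↦ D.chart_mem_carrier.2
    (mem_closedBall_zero_iff.1 (𝒟.carrier_subset_closedBall i hw))

/-- The family obtained by replacing each disc of `𝒟` by a similar copy of a finite family. -/
noncomputable def sigma {ι : Type*} {κ : ι → Type*} [∀ i, Finite (κ i)] (𝒟 : DiscFamily ι)
    (ℰ : ∀ i, DiscFamily (κ i)) : DiscFamily (Σ i, κ i) where
  disc p := (𝒟.disc p.1).comp ((ℰ p.1).disc p.2)
  norm_center_add_radius_le p := by
    set D := 𝒟.disc p.1
    set D' := (ℰ p.1).disc p.2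
    calc ‖D.center + D.radius • D'.center‖ + D.radius * D'.radius
        ≤ ‖D.center‖ + ‖D.radius • D'.center‖ + D.radius * D'.radius := by
          gcongr
          exact norm_add_le _ _
      _ = ‖D.center‖ + D.radius * (‖D'.center‖ + D'.radius) := by
          rw [norm_smul, Real.norm_of_nonneg D.radius_pos.le]
          ring
      _ ≤ ‖D.center‖ + D.radius := by
          gcongr
          exact mul_le_of_le_one_right D.radius_pos.le ((ℰ p.1).norm_center_add_radius_le p.2)
      _ ≤ 1 := 𝒟.norm_center_add_radius_le p.1
  pairwise_disjoint := by
    rintro ⟨i, k⟩ ⟨j, l⟩ hne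
    by_cases hij : i = j
    · subst hij
      rw [Disc.carrier_comp, Disc.carrier_comp, disjoint_image_iff (𝒟.disc i).chart.injective]
      exact (ℰ i).pairwise_disjoint fun hkl ↦ hne (congrArg _ hkl)
    · exact (𝒟.pairwise_disjoint hij).mono ((ℰ i).carrier_comp_subset _ k)
        ((ℰ j).carrier_comp_subset _ l)
  tendsto_smallSets := tendsto_smallSets_iff.2 fun U hU ↦ by
    have hfin := eventually_cofinite.1 (tendsto_smallSets_iff.1 𝒟.tendsto_smallSets U hU)
    refine (hfin.biUnion fun i _ ↦ finite_range (Sigma.mk i)).subset fun p hp ↦ ?_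
    exact mem_biUnion (fun hsub ↦ hp (((ℰ p.1).carrier_comp_subset _ p.2).trans hsub)) ⟨p.2, rfl⟩

end DiscFamily

/-- Discs of radii `2⁻ⁿ / 8` which shrink to the origin. -/
noncomputable def dyadicDiscs : DiscFamily ℕ where
  disc n := ⟨(3 / 4 * (1 / 2) ^ n : ℝ), (1 / 2) ^ n / 8, by positivity⟩
  norm_center_add_radius_le n := by
    have hpow : (1 / 2 : ℝ) ^ n ≤ 1 := pow_le_one₀ (by norm_num) (by norm_num)
    have hpos : (0 : ℝ) < (1 / 2) ^ n := by positivity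
    simp only
    rw [Complex.norm_of_nonneg (by positivity)]
    linarith
  pairwise_disjoint := by
    refine (pairwise_disjoint_on _).2 fun m n hmn ↦ closedBall_disjoint_closedBall ?_
    have hpow : (1 / 2 : ℝ) ^ n ≤ (1 / 2) ^ (m + 1) :=
      pow_le_pow_of_le_one (by norm_num) (by norm_num) hmn
    have hpos : (0 : ℝ) < (1 / 2) ^ n := by positivity
    rw [pow_succ] at hpow
    simp only
    rw [Complex.dist_eq, ← Complex.ofReal_sub, Complex.norm_of_nonneg (by linarith)]
    linarith
  tendsto_smallSets := by
    have hpow : Tendsto (fun n : ℕ ↦ (1 / 2 : ℝ) ^ n) cofinite (𝓝 0) :=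
      Nat.cofinite_eq_atTop ▸ tendsto_pow_atTop_nhds_zero_of_lt_one (by norm_num) (by norm_num)
    refine ((tendsto_closedBall_smallSets (0 : ℂ)).comp hpow).smallSets_mono <|
      Eventually.of_forall fun n ↦ closedBall_subset_closedBall' ?_
    have hpos : (0 : ℝ) < (1 / 2) ^ n := by positivity
    simp only
    rw [dist_zero_right, Complex.norm_of_nonneg (by positivity)]
    linarith

theorem zero_notMem_dyadicDiscs (n : ℕ) : 0 ∉ (dyadicDiscs.disc n).carrier := by
  have hpos : (0 : ℝ) < (1 / 2) ^ n := by positivity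
  rw [Disc.carrier, mem_closedBall, dist_zero_left, not_le, dyadicDiscs,
    Complex.norm_of_nonneg (by positivity)]
  simp only
  linarith

theorem exists_discFamily_tsum_eq_top {t : ℝ} (ht : t < 2) :
    ∃ (ι : Type) (_ : Countable ι) (𝒟 : DiscFamily ι), (∀ i, 0 ∉ (𝒟.disc i).carrier) ∧
      ∀ d ≤ t, ∑' i, ENNReal.ofReal ((𝒟.disc i).radius ^ d) = ⊤ := by
  choose n ℰ hℰ using fun N ↦
    exists_discFamily_one_le_sum_rpow (dyadicDiscs.disc N).radius_pos ht
  refine ⟨Σ N, Fin (n N), inferInstance, dyadicDiscs.sigma ℰ, fun p hp ↦ ?_, fun d hd ↦ ?_⟩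
  · exact zero_notMem_dyadicDiscs p.1 ((ℰ p.1).carrier_comp_subset _ p.2 hp)
  set 𝒟 := dyadicDiscs.sigma ℰ
  have hone (N : ℕ) : 1 ≤ ∑' i, ENNReal.ofReal ((𝒟.disc ⟨N, i⟩).radius ^ d) := by
    rw [tsum_fintype, ← ENNReal.ofReal_sum_of_nonneg fun i _ ↦
      Real.rpow_nonneg (𝒟.disc ⟨N, i⟩).radius_pos.le d]
    refine ENNReal.one_le_ofReal.2 ((hℰ N).trans (Finset.sum_le_sum fun i _ ↦ ?_))
    exact Real.rpow_le_rpow_of_exponent_ge (𝒟.disc ⟨N, i⟩).radius_pos (𝒟.radius_le_one ⟨N, i⟩) hd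
  rw [ENNReal.tsum_sigma']
  refine top_unique ?_
  rw [← ENNReal.tsum_const_eq_top_of_ne_zero (α := ℕ) one_ne_zero]
  exact ENNReal.tsum_le_tsum hone

end DiscPackings

section CriticalPackings

namespace DiscFamily

variable {ι : Type*} [Fintype ι] (𝒟 : DiscFamily ι)

/-- The proportion of the area of the unit disc that is covered by the discs of the family. -/
noncomputable def area : ℝ := ∑ i, (𝒟.disc i).radius ^ 2

/-- The proportion of the area covered by the family that belongs to the `i`-th disc. -/
noncomputable def weight (i : ι) : ℝ := (𝒟.disc i).radius ^ 2 / 𝒟.area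

variable {𝒟}

theorem weight_pos (h : 0 < 𝒟.area) (i : ι) : 0 < 𝒟.weight i :=
  div_pos (pow_pos (𝒟.disc i).radius_pos 2) h

theorem sum_weight (h : 0 < 𝒟.area) : ∑ i, 𝒟.weight i = 1 := by
  simp only [weight, ← Finset.sum_div]
  exact div_self h.ne'

theorem weight_le_two_mul_sq (h : 1 / 2 ≤ 𝒟.area) (i : ι) :
    𝒟.weight i ≤ 2 * (𝒟.disc i).radius ^ 2 := by
  rw [weight, div_le_iff₀ (one_half_pos.trans_le h)]
  nlinarith [sq_nonneg (𝒟.disc i).radius]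

end DiscFamily

/-- The packing covers at least half of the area, and in dimension `t` the inner discs carry the
same weights as the areas of the discs of the packing. -/
structure NestedPacking.IsCritical (P : NestedPacking) (t : ℝ) : Prop where
  half_le_area : 1 / 2 ≤ P.discs.area
  inner_radius_rpow : ∀ i, (P.inner.disc i).radius ^ t = P.discs.weight i

theorem NestedPacking.exists_isCritical {t η : ℝ} (ht0 : 0 < t) (ht : t < 2) (hη : 1 / 2 ≤ η)
    (hη1 : η < 1) : ∃ P : NestedPacking, P.IsCritical t ∧ η ≤ P.discs.area := by
  obtain ⟨δ, hδ, hδt⟩ := exists_forall_le_two_mul_sq_le_rpow (one_half_pos (α := ℝ)) ht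
  obtain ⟨n, 𝒟, hradius, hη𝒟⟩ := exists_discFamily_le_sum_radius_sq hδ hη1
  have harea : 1 / 2 ≤ 𝒟.area := hη.trans hη𝒟
  have hw (i : Fin n) : 0 < 𝒟.weight i := DiscFamily.weight_pos (one_half_pos.trans_le harea) i
  have hr (i : Fin n) : 0 < (𝒟.disc i).radius := (𝒟.disc i).radius_pos
  have hratio (i : Fin n) : 𝒟.weight i ^ t⁻¹ / (𝒟.disc i).radius ≤ 1 / 2 := by
    rw [div_le_iff₀ (hr i), Real.rpow_inv_le_iff_of_pos (hw i).le (by linarith [hr i]) ht0]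
    exact (DiscFamily.weight_le_two_mul_sq harea i).trans (hδt _ (hr i) (hradius i))
  refine ⟨⟨n, 𝒟, fun i ↦ 𝒟.weight i ^ t⁻¹ / (𝒟.disc i).radius,
    fun i ↦ div_pos (Real.rpow_pos_of_pos (hw i) _) (hr i), hratio⟩, ⟨harea, fun i ↦ ?_⟩, hη𝒟⟩
  change (𝒟.weight i ^ t⁻¹ / (𝒟.disc i).radius * (𝒟.disc i).radius) ^ t = 𝒟.weight i
  rw [div_mul_cancel₀ _ (hr i).ne', Real.rpow_inv_rpow (hw i).le ht0.ne']

theorem NestedPacking.exists_isCritical_seq {t : ℝ} (ht0 : 0 < t) (ht : t < 2) :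
    ∃ P : ℕ → NestedPacking, ∀ n, (P n).IsCritical t ∧
      Real.exp (-((1 / 2) ^ n / 2)) ≤ (P n).discs.area := by
  refine ⟨_, fun n ↦ (NestedPacking.exists_isCritical ht0 ht ?_ ?_).choose_spec⟩
  · have hpow : (1 / 2 : ℝ) ^ n ≤ 1 := pow_le_one₀ (by norm_num) (by norm_num)
    linarith [Real.add_one_le_exp (-((1 / 2 : ℝ) ^ n / 2))]
  · exact (Real.exp_lt_exp.2 (neg_lt_zero.2 (by positivity))).trans_eq Real.exp_zero

/-- The largest dimension of the image of a set of dimension `d` under a `K`-quasiconformal map. -/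
noncomputable def stretchedDim (K d : ℝ) : ℝ := 2 * K * d / (2 + (K - 1) * d)

section StretchedDim

variable {K d : ℝ} (hK : 1 ≤ K) (hd : 0 < d)
include hK hd

theorem stretchedDim_denom_pos : 0 < 2 + (K - 1) * d :=
  add_pos_of_pos_of_nonneg two_pos (mul_nonneg (sub_nonneg.2 hK) hd.le)

theorem stretchedDim_mul : stretchedDim K d * (1 + (K - 1) * d / 2) = K * d := by
  rw [stretchedDim, div_mul_eq_mul_div, div_eq_iff (stretchedDim_denom_pos hK hd).ne']
  ring

theorem le_stretchedDim (hd2 : d ≤ 2) : d ≤ stretchedDim K d := by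
  rw [stretchedDim, le_div_iff₀ (stretchedDim_denom_pos hK hd)]
  nlinarith [mul_nonneg hd.le (mul_nonneg (sub_nonneg.2 hK) (sub_nonneg.2 hd2))]

theorem stretchedDim_lt_two (hd2 : d < 2) : stretchedDim K d < 2 := by
  rw [stretchedDim, div_lt_iff₀ (stretchedDim_denom_pos hK hd)]
  nlinarith

end StretchedDim

theorem stretchedDim_two_div {K : ℝ} (hK : 1 ≤ K) : stretchedDim K (2 / (K + 1)) = 1 := by
  have hK1 : 0 < K + 1 := by linarith
  rw [stretchedDim, div_eq_one_iff_eq (stretchedDim_denom_pos hK (by positivity)).ne']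
  field_simp
  ring

namespace NestedPacking.IsCritical

variable {P : NestedPacking} {t : ℝ}

theorem area_pos (hP : P.IsCritical t) : 0 < P.discs.area := one_half_pos.trans_le hP.half_le_area

theorem isFrostmanWeight (hP : P.IsCritical t) : IsFrostmanWeight P t P.discs.weight where
  nonneg i := (DiscFamily.weight_pos hP.area_pos i).le
  sum_eq_one := DiscFamily.sum_weight hP.area_pos
  le_radius_sq := DiscFamily.weight_le_two_mul_sq hP.half_le_area
  le_inner_radius_rpow i := (hP.inner_radius_rpow i).ge

theorem sum_inner_radius_rpow (hP : P.IsCritical t) : ∑ i, (P.inner.disc i).radius ^ t = 1 := by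
  simp only [hP.inner_radius_rpow, DiscFamily.sum_weight hP.area_pos]

variable {K d : ℝ} (hK : 1 ≤ K) (hd : 0 < d) (hP : P.IsCritical (stretchedDim K d))
include hd hP

theorem source_radius_rpow (i : Fin P.card) : ((P.source hK).disc i).radius ^ d
    = P.discs.weight i * P.discs.area ^ (-((K - 1) * d / 2)) := by
  set γ := (K - 1) * d / 2 with hγ
  set w := P.discs.weight i
  set r := (P.discs.disc i).radius
  have hr : 0 < r := (P.discs.disc i).radius_pos
  have hw : 0 < w := DiscFamily.weight_pos hP.area_pos i
  have hcritical : (P.ratio i * r) ^ stretchedDim K d = w := hP.inner_radius_rpow i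
  have hinner : (P.ratio i * r) ^ (K * d) = w * w ^ γ := by
    rw [← stretchedDim_mul hK hd, Real.rpow_mul (mul_pos (P.ratio_pos i) hr).le, hcritical,
      Real.rpow_add hw, Real.rpow_one]
  have hr_sq : r ^ d = r ^ (K * d) * (r ^ 2) ^ (-γ) := by
    rw [← Real.rpow_two, ← Real.rpow_mul hr.le, ← Real.rpow_add hr, hγ]
    ring_nf
  have harea : P.discs.area ^ (-γ) = w ^ γ * (r ^ 2) ^ (-γ) := by
    have hw_div : P.discs.area = r ^ 2 / w := by
      rw [eq_div_iff hw.ne']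
      exact mul_div_cancel₀ _ hP.area_pos.ne'
    rw [hw_div, Real.div_rpow (sq_nonneg r) hw.le, Real.rpow_neg hw.le, div_inv_eq_mul, mul_comm]
  calc (P.ratio i ^ K * r) ^ d = (P.ratio i * r) ^ (K * d) * (r ^ 2) ^ (-γ) := by
        rw [Real.mul_rpow (P.ratio_rpow_pos K i).le hr.le, ← Real.rpow_mul (P.ratio_pos i).le,
          hr_sq, ← mul_assoc, ← Real.mul_rpow (P.ratio_pos i).le hr.le]
    _ = w * P.discs.area ^ (-γ) := by rw [hinner, harea, mul_assoc]

theorem sum_source_radius_rpow :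
    ∑ i, ((P.source hK).disc i).radius ^ d = P.discs.area ^ (-((K - 1) * d / 2)) := by
  simp only [source_radius_rpow hK hd hP, ← Finset.sum_mul, DiscFamily.sum_weight hP.area_pos,
    one_mul]

theorem isFrostmanWeight_rpow : IsFrostmanWeight (P.rpow hK) d P.discs.weight where
  nonneg := hP.isFrostmanWeight.nonneg
  sum_eq_one := hP.isFrostmanWeight.sum_eq_one
  le_radius_sq := hP.isFrostmanWeight.le_radius_sq
  le_inner_radius_rpow i := by
    have hexp : -((K - 1) * d / 2) ≤ 0 := by
      have hK1 : 0 ≤ K - 1 := sub_nonneg.2 hK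
      exact neg_nonpos.2 (by positivity)
    refine le_of_le_of_eq ?_ (source_radius_rpow hK hd hP i).symm
    exact le_mul_of_one_le_right (hP.isFrostmanWeight.nonneg i)
      (Real.one_le_rpow_of_pos_of_le_one_of_nonpos hP.area_pos P.discs.sum_radius_sq_le_one hexp)

end NestedPacking.IsCritical

theorem prod_rpow_neg_le_exp {a : ℕ → ℝ} (ha : ∀ n, Real.exp (-((1 / 2) ^ n / 2)) ≤ a n) {γ : ℝ}
    (hγ : 0 ≤ γ) (n : ℕ) : ∏ j ∈ Finset.range n, a j ^ (-γ) ≤ Real.exp γ := by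
  have hpos (j : ℕ) : 0 < a j := (Real.exp_pos _).trans_le (ha j)
  have hle (j : ℕ) : a j ^ (-γ) ≤ Real.exp ((1 / 2) ^ j * (γ / 2)) := by
    refine (Real.rpow_le_rpow_of_nonpos (Real.exp_pos _) (ha j) (neg_nonpos.2 hγ)).trans_eq ?_
    rw [← Real.exp_mul]
    ring_nf
  have hgeom : ∑ j ∈ Finset.range n, (1 / 2 : ℝ) ^ j ≤ 2 :=
    (summable_geometric_two.sum_le_tsum _ fun j _ ↦ by positivity).trans_eq tsum_geometric_two
  calc ∏ j ∈ Finset.range n, a j ^ (-γ)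
      ≤ ∏ j ∈ Finset.range n, Real.exp ((1 / 2) ^ j * (γ / 2)) :=
        Finset.prod_le_prod (fun j _ ↦ Real.rpow_nonneg (hpos j).le _) fun j _ ↦ hle j
    _ = Real.exp ((∑ j ∈ Finset.range n, (1 / 2) ^ j) * (γ / 2)) := by
        rw [← Real.exp_sum, Finset.sum_mul]
    _ ≤ Real.exp γ := Real.exp_le_exp.2 (by nlinarith)

end CriticalPackings

section Main

variable {K d : ℝ} (hK : 1 ≤ K) (hd0 : 0 < d) (hd2 : d < 2)
include hK hd0 hd2

theorem exists_isQCApprox_hausdorffMeasure_pos_lt_top :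
    ∃ (E : Set ℂ) (f : ℕ → DiscHomeo) (φ : DiscHomeo), IsCompact E ∧ E ⊆ closedBall 0 1 ∧
      IsQCApprox K f φ ∧ (0 < μH[d] E ∧ μH[d] E < ⊤) ∧
      0 < μH[stretchedDim K d] (φ '' E) ∧ μH[stretchedDim K d] (φ '' E) < ⊤ := by
  have ht0 : 0 < stretchedDim K d := hd0.trans_le (le_stretchedDim hK hd0 hd2.le)
  have ht2 : stretchedDim K d < 2 := stretchedDim_lt_two hK hd0 hd2
  obtain ⟨P, hP⟩ := NestedPacking.exists_isCritical_seq ht0 ht2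
  obtain ⟨f, φ, hφ, himage⟩ := exists_isQCApprox_image_range_codeLimit hK P
  have hsource (n i) : (((P n).source hK).disc i).radius ≤ 1 / 2 :=
    ((P n).rpow hK).inner_radius_le_half i
  refine ⟨_, f, φ, isCompact_range (continuous_codeLimit hsource),
    range_codeLimit_subset_closedBall hsource, hφ, ⟨?_, ?_⟩, ?_⟩
  · exact IsFrostmanWeight.hausdorffMeasure_range_codeLimit_pos
      (fun n ↦ (hP n).1.isFrostmanWeight_rpow hK hd0) hd0 hd2.le
  · refine hausdorffMeasure_range_codeLimit_lt_top hsource hd0.le (C := Real.exp ((K - 1) * d / 2))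
      fun n ↦ ?_
    simp only [(hP _).1.sum_source_radius_rpow hK hd0]
    exact prod_rpow_neg_le_exp (fun n ↦ (hP n).2) (by nlinarith) n
  · rw [himage]
    refine ⟨IsFrostmanWeight.hausdorffMeasure_range_codeLimit_pos
      (fun n ↦ (hP n).1.isFrostmanWeight) ht0 ht2.le, ?_⟩
    refine hausdorffMeasure_range_codeLimit_lt_top (fun n ↦ (P n).inner_radius_le_half) ht0.le
      (C := 1) fun n ↦ ?_
    simp only [(hP _).1.sum_inner_radius_rpow, Finset.prod_const_one, le_rfl]

theorem exists_isCompact_isQuasiconformal :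
    ∃ (F : Set ℂ) (φ : ℂ ≃ₜ ℂ), IsCompact F ∧ IsQuasiconformal K φ ∧
      μH[d] F = ⊤ ∧ SigmaFinite ((μH[d] : Measure ℂ).restrict F) ∧
      μH[stretchedDim K d] (φ '' F) = ⊤ ∧
      SigmaFinite ((μH[stretchedDim K d] : Measure ℂ).restrict (φ '' F)) := by
  obtain ⟨E, f, φ, hE, hE1, hφ, ⟨hpos, hfin⟩, hpos', hfin'⟩ :=
    exists_isQCApprox_hausdorffMeasure_pos_lt_top hK hd0 hd2
  have hdt : d ≤ stretchedDim K d := le_stretchedDim hK hd0 hd2.le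
  have ht0 : 0 < stretchedDim K d := hd0.trans_le hdt
  obtain ⟨ι, _, 𝒟, h0, hsum⟩ := exists_discFamily_tsum_eq_top (stretchedDim_lt_two hK hd0 hd2)
  have hφE : IsCompact (φ '' E) := hE.image φ.continuous
  have hφE1 : φ '' E ⊆ closedBall 0 1 := image_subset_iff.2 fun w hw ↦
    mem_closedBall_zero_iff.2 (φ.norm_apply_le_one (mem_closedBall_zero_iff.1 (hE1 hw)))
  have himage : (𝒟.paste fun _ ↦ φ).toHomeomorph '' 𝒟.copies E = 𝒟.copies (φ '' E) :=
    𝒟.paste_image_copies h0 φ hE1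
  refine ⟨𝒟.copies E, (𝒟.paste fun _ ↦ φ).toHomeomorph, 𝒟.isCompact_copies hE hE1,
    (hφ.paste 𝒟 hK).isQuasiconformal (zero_le_one.trans hK), ?_,
    𝒟.sigmaFinite_restrict_copies hd0 hE hfin, ?_, ?_⟩
  · rw [𝒟.hausdorffMeasure_copies hd0 hE hE1, hsum d hdt, ENNReal.top_mul hpos.ne']
  · rw [himage, 𝒟.hausdorffMeasure_copies ht0 hφE hφE1, hsum _ le_rfl, ENNReal.top_mul hpos'.ne']
  · rw [himage]
    exact 𝒟.sigmaFinite_restrict_copies ht0 hφE hfin'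

end Main

theorem corollary3p5 (K : ℝ) (hK : 1 ≤ K) :
    (∃ (F : Set ℂ) (φ : ℂ ≃ₜ ℂ), IsCompact F ∧ IsQuasiconformal K φ ∧
      μH[2 / (K + 1)] F = ⊤ ∧
      SigmaFinite ((μH[2 / (K + 1)] : Measure ℂ).restrict F) ∧
      μH[1] (φ '' F) = ⊤ ∧
      SigmaFinite ((μH[1] : Measure ℂ).restrict (φ '' F))) ∧
    ∀ d : ℝ, 0 < d → d < 2 →
      ∃ (F : Set ℂ) (φ : ℂ ≃ₜ ℂ), IsCompact F ∧ IsQuasiconformal K φ ∧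
        μH[d] F = ⊤ ∧
        SigmaFinite ((μH[d] : Measure ℂ).restrict F) ∧
        μH[2 * K * d / (2 + (K - 1) * d)] (φ '' F) = ⊤ ∧
        SigmaFinite
          ((μH[2 * K * d / (2 + (K - 1) * d)] : Measure ℂ).restrict (φ '' F)) := by
  have hK1 : 0 < K + 1 := by linarith
  have hlt : 2 / (K + 1) < 2 := by
    rw [div_lt_iff₀ hK1]
    linarith
  constructor
  · simpa only [stretchedDim_two_div hK] using
      exists_isCompact_isQuasiconformal hK (div_pos two_pos hK1) hlt
  · exact fun d hd0 hd2 ↦ exists_isCompact_isQuasiconformal hK hd0 hd2
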